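/- Let $n\ge 1$. A weight is a nonnegative locally integrable function on $\mathbb R^n$, cubes $Q$ have sides parallel to the axes, $w(Q)=\int_Q w$, and $t'=t/(t-1)$ for $1<t<\infty$. For $1<t<\infty$, $w\in A_t$ means that $w$ is a weight, $w>0$ a.e., and $\sup_Q \frac{w(Q)}{|Q|}\bigl(\frac{w^{1-t'}(Q)}{|Q|}\bigr)^{t-1}<\infty$. For $1<\sigma<\infty$, $w\in RH_\sigma$ means that $w$ is a weight and $\bigl(\frac1{|Q|}\int_Q w^\sigma\bigr)^{1/\sigma}\le \frac{K}{|Q|}\int_Q w$ for all cubes $Q$, with $K$ independent of $Q$. Let $\|f\,|\,L_{p,w}(S)\|=(\int_S|f|^p w)^{1/p}$, and let $L^r_p(w)$ and $L^r_p(\lambda,w)$ be the spaces of (classes of) measurable $f:\mathbb R^n\to\mathbb C$ for which, respectively, $$\sup_Q w(Q)^{-(\frac1p+\frac rn)}\|f\,|\,L_{p,w}(Q)\|<\infty,\qquad \sup_Q |Q|^{-(\frac1p+\frac rn)}\|f\,|\,L_{p,w}(Q)\|<\infty ,$$ with these suprema as quasinorms. Let $Mg(x)=\sup_{Q\ni x}\frac1{|Q|}\int_Q|g|$.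 Let $1\le\gamma<p<\infty$, $-n/p\le r<0$ and $w\in A_{p/\gamma}$. Then there is $q_0\in(\gamma,p)$ such that for every $q\in[\gamma,q_0]$ the following hold. 1. There is $s_0=s_0(q)>1$ such that for every $s\in(1,s_0]$: (a) there is a finite constant $c$ such that for every cube $Q$ and every $h\in L_{(p/q)',w}(Q)$ of norm $1$, the function $M(|h|^sw^s\chi_Q)^{1/s}$ is a weight and $L^r_p(w)$ is continuously embedded into $L_{q,M(|h|^sw^s\chi_Q)^{1/s}}(\mathbb R^n)$ with constant at most $c\,w(Q)^{1/p+r/n}$; (b) if in addition $w\in RH_\sigma$ and $r\le -n/(p\sigma)$ for some $\sigma\in(1,\infty)$, there is a finite constant $c$ such that for every cube $Q$ and every $h\in L_{(p/q)',w}(Q)$ of norm $1$, $L^r_p(\lambda,w)$ is continuously embedded into $L_{q,M(|h|^sw^s\chi_Q)^{1/s}}(\mathbb R^n)$ with constant at most $c\,|Q|^{1/p+r/n}$. 2. There is $0<\alpha<n$ such that $L^r_p(w)$ is continuously embedded into $L_{q,(1+|x|)^{-\alpha}}(\mathbb R^n)$ and, if in addition $w\in RH_\sigma$ and $r\le -n/(p\sigma)$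 for some $\sigma\in(1,\infty)$, so is $L^r_p(\lambda,w)$. -/

import Mathlib

open MeasureTheory Set
open scoped ENNReal NNReal

noncomputable section

namespace WeightedMorrey

/-- The space `ℝⁿ` with the Euclidean norm and Lebesgue measure. -/
abbrev Rn (n : ℕ) : Type := EuclideanSpace ℝ (Fin n)

/-- The closed cube with centre `a`, side-length `2 * ρ` and sides parallel to the axes.
It is used with `0 < ρ` only. -/
def cube {n : ℕ} (a : Rn n) (ρ : ℝ) : Set (Rn n) :=
  {x | ∀ i, |x i - a i| ≤ ρ}

/-- `w(S) = ∫_S w`. Weights are represented by functions with values in `[0, ∞]`; those that are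
locally integrable are finite almost everywhere. -/
def wMeas {n : ℕ} (w : Rn n → ℝ≥0∞) (S : Set (Rn n)) : ℝ≥0∞ :=
  ∫⁻ x in S, w x

/-- A weight: a nonnegative locally integrable function. -/
def IsWeight {n : ℕ} (w : Rn n → ℝ≥0∞) : Prop :=
  LocallyIntegrable w volume

/-- The average of a nonnegative function over the cube with centre `a` and side-length `2 * ρ`. -/
def cubeAvg {n : ℕ} (g : Rn n → ℝ≥0∞) (a : Rn n) (ρ : ℝ) : ℝ≥0∞ :=
  wMeas g (cube a ρ) / volume (cube a ρ)

/-- The Muckenhoupt constant `[w]_{A_p} = sup_Q (w(Q)/|Q|) (w^{1-p'}(Q)/|Q|)^{p-1}`, `1 < p < ∞`,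
where `p' = p/(p-1)`. -/
def ApConst {n : ℕ} (p : ℝ) (w : Rn n → ℝ≥0∞) : ℝ≥0∞ :=
  ⨆ (a : Rn n) (ρ : ℝ) (_ : 0 < ρ),
    cubeAvg w a ρ * cubeAvg (fun x => w x ^ (1 - Real.conjExponent p)) a ρ ^ (p - 1)

/-- The Muckenhoupt class `A_p`, `1 < p < ∞`. -/
structure IsAp {n : ℕ} (p : ℝ) (w : Rn n → ℝ≥0∞) : Prop where
  isWeight : IsWeight w
  pos : ∀ᵐ x, 0 < w x
  const_lt_top : ApConst p w < ∞

/-- The reverse Hölder class `RH_σ`, `1 < σ < ∞`. -/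
structure IsRH {n : ℕ} (σ : ℝ) (w : Rn n → ℝ≥0∞) : Prop where
  isWeight : IsWeight w
  reverse_holder : ∃ K : ℝ≥0, ∀ (a : Rn n) (ρ : ℝ), 0 < ρ →
    cubeAvg (fun x => w x ^ σ) a ρ ^ (1 / σ) ≤ K * cubeAvg w a ρ

/-- The (uncentred) Hardy-Littlewood maximal function over cubes of a nonnegative function. -/
def maximalFn {n : ℕ} (g : Rn n → ℝ≥0∞) (x : Rn n) : ℝ≥0∞ :=
  ⨆ (a : Rn n) (ρ : ℝ) (_ : 0 < ρ) (_ : x ∈ cube a ρ), cubeAvg g a ρ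

/-- The quasinorm `‖f | L_{p,w}(S)‖ = (∫_S |f|^p w)^{1/p}`, `0 < p < ∞`. -/
def lpwNorm {n : ℕ} (p : ℝ) (w : Rn n → ℝ≥0∞) (S : Set (Rn n)) (f : Rn n → ℂ) : ℝ≥0∞ :=
  (∫⁻ x in S, ‖f x‖ₑ ^ p * w x) ^ (1 / p)

/-- The quasinorm of the Morrey space `L^r_p(w, ℝⁿ)`. -/
def morreyNorm {n : ℕ} (p r : ℝ) (w : Rn n → ℝ≥0∞) (f : Rn n → ℂ) : ℝ≥0∞ :=
  ⨆ (a : Rn n) (ρ : ℝ) (_ : 0 < ρ),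
    wMeas w (cube a ρ) ^ (-(1 / p + r / n)) * lpwNorm p w (cube a ρ) f

/-- The quasinorm of the Morrey space `L^r_p(λ, w, ℝⁿ)`, normalized by Lebesgue measure. -/
def morreyLambdaNorm {n : ℕ} (p r : ℝ) (w : Rn n → ℝ≥0∞) (f : Rn n → ℂ) : ℝ≥0∞ :=
  ⨆ (a : Rn n) (ρ : ℝ) (_ : 0 < ρ),
    volume (cube a ρ) ^ (-(1 / p + r / n)) * lpwNorm p w (cube a ρ) f

/-- The space of measurable functions `f` with `N₁ f < ∞` is continuously embedded into the one of
those with `N₂ f < ∞`, with embedding constant at most `C`. -/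
def EmbedsWith {n : ℕ} (N₁ N₂ : (Rn n → ℂ) → ℝ≥0∞) (C : ℝ≥0∞) : Prop :=
  ∀ f : Rn n → ℂ, AEStronglyMeasurable f volume → N₁ f < ∞ → N₂ f < ∞ ∧ N₂ f ≤ C * N₁ f

/-- `h` is a measurable function on `S` with `‖h | L_{p,w}(S)‖ = 1`. -/
def IsUnitOn {n : ℕ} (p : ℝ) (w : Rn n → ℝ≥0∞) (S : Set (Rn n)) (h : Rn n → ℂ) : Prop :=
  AEStronglyMeasurable h (volume.restrict S) ∧ lpwNorm p w S h = 1

/-- The weight `M(|h|^s w^s χ_S)^{1/s}`. -/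
def dualWeight {n : ℕ} (s : ℝ) (h : Rn n → ℂ) (w : Rn n → ℝ≥0∞) (S : Set (Rn n)) :
    Rn n → ℝ≥0∞ :=
  fun x => maximalFn (S.indicator fun y => ‖h y‖ₑ ^ s * w y ^ s) x ^ (1 / s)

/-- The weight `(1 + |x|)^{-α}`. -/
def polyWeight (n : ℕ) (α : ℝ) : Rn n → ℝ≥0∞ :=
  fun x => ENNReal.ofReal ((1 + ‖x‖) ^ (-α))

end WeightedMorrey

end

/-! Fix a cube `Q` and a normalized `h`, and put `u = p / q`, `σ = w^{1-u'}`, `G = |h|^s w^s χ_Q`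
and `F = (MG)^{1/s}`. The integral of `|f|^q F` is estimated separately on `2Q` and on the annuli
`2^{j+2}Q \ 2^{j+1}Q`.

On `2Q`, Hölder's inequality pairs `|f|^q` in `L_u(w)` with `F` in `L_{u'}(σ)`. The normalization of
`h` says that `G` has norm one in `L_{u'/s}(σ)`. The weight `σ` lies in `A_{u'}`, hence in some
`A_{t₀}` with `t₀ < u'`, so `M` is bounded on `L_{u'/s}(σ)` for `s` close to 1
(`IsMuckenhoupt.exists_lt`, `IsMuckenhoupt.lintegral_maximalFn_le`).

Away from `Q`, the maximal function of a function supported in `Q` decays like the inverse volume,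
so `F ≲ 2^{-jn/s} σ(Q)^{-1/u'}` (`maximalFn_mul_le`, `IsMuckenhoupt.exists_dualWeight_bounds`). Let
`Φ(Q)` be `w(Q)^{1/p+r/n}` or `|Q|^{1/p+r/n}`. If `Φ(Q) / w(Q)^{1/p}` loses a factor `2^{-jδ}` from
`Q` to `2^j Q`, the Muckenhoupt condition yields `∫_{2^j Q} |f|^q ≲ 2^{j(n-δq)} σ(Q)^{1/u'} (Φ(Q)
‖f‖)^q` (`setLIntegral_cube_two_pow_le`). The annuli then sum to a geometric series as soon as `n(1
- 1/s) < δq`.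

The decay comes from reverse Hölder inequalities, which force `w(2^j Q)` to grow like a power of
`2^j` (`RevHolder.exists_decay`). For the first space the quotient is `w(Q)^{r/n}` with `r < 0`. For
the second one, `RH_τ` gives `δ = -r - n/(pτ)`; self-improvement to some `τ > σ`, where `σ` is now
the given reverse Hölder exponent, makes this positive even when `r = -n/(pσ)`
(`IsMuckenhoupt.exists_revHolder_gt`, `exists_dilationDecay`).

Openness of the Muckenhoupt classes also gives `q₀`: `w` lies in `A_{p/q}` for all `q` in `[γ, q₀]`.
The polynomial weight is dominated by the dual weight of one fixed cube, with `h` a multiple of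
`1/w` (`exists_polyWeight_le_dualWeight`). All the weight theory is derived from Calderón-Zygmund
stopping cubes and Vitali coverings. -/

namespace WeightedMorrey

/-! ### Geometry and volume of cubes -/

section Cubes

variable {n : ℕ}

theorem cube_eq_preimage (a : Rn n) (ρ : ℝ) :
    cube a ρ = WithLp.ofLp ⁻¹' Icc (fun i => a i - ρ) (fun i => a i + ρ) := by
  ext x
  simp only [cube, mem_ofPred_eq, mem_preimage, mem_Icc, Pi.le_def, abs_le, ← forall_and]
  exact forall_congr' fun i => ⟨fun h => ⟨by linarith, by linarith⟩,
    fun h => ⟨by linarith, by linarith⟩⟩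

theorem isClosed_cube (a : Rn n) (ρ : ℝ) : IsClosed (cube a ρ) := by
  rw [cube_eq_preimage]
  exact isClosed_Icc.preimage (PiLp.continuous_ofLp 2 _)

theorem measurableSet_cube (a : Rn n) (ρ : ℝ) : MeasurableSet (cube a ρ) :=
  (isClosed_cube a ρ).measurableSet

theorem volume_cube (a : Rn n) (ρ : ℝ) : volume (cube a ρ) = ENNReal.ofReal (2 * ρ) ^ n := by
  rw [cube_eq_preimage, (PiLp.volume_preserving_ofLp (Fin n)).measure_preimage
    measurableSet_Icc.nullMeasurableSet, Real.volume_Icc_pi]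
  simp [show ∀ i, a i + ρ - (a i - ρ) = 2 * ρ by intro i; ring]

theorem volume_cube_pos (a : Rn n) {ρ : ℝ} (hρ : 0 < ρ) : 0 < volume (cube a ρ) := by
  rw [volume_cube]
  exact ENNReal.pow_pos (by simpa using hρ) _

theorem volume_cube_lt_top (a : Rn n) (ρ : ℝ) : volume (cube a ρ) < ∞ := by
  rw [volume_cube]
  exact ENNReal.pow_lt_top ENNReal.ofReal_lt_top

theorem volume_cube_mul (a b : Rn n) {ρ : ℝ} {c : ℝ} (hc : 0 ≤ c) :
    volume (cube b (c * ρ)) = ENNReal.ofReal c ^ n * volume (cube a ρ) := by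
  rw [volume_cube, volume_cube, ← mul_pow, ← ENNReal.ofReal_mul hc]
  congr 2
  ring

theorem volume_cube_two_pow_mul (a : Rn n) (ρ : ℝ) (j : ℕ) :
    volume (cube a (2 ^ j * ρ)) = 2 ^ ((j : ℝ) * n) * volume (cube a ρ) := by
  rw [volume_cube_mul a a (by positivity), ENNReal.ofReal_pow (by norm_num), ← pow_mul,
    ← Nat.cast_mul, ENNReal.rpow_natCast]
  simp

theorem cube_subset_cube {a b : Rn n} {ρ ρ' : ℝ} (h : ∀ i, |a i - b i| + ρ ≤ ρ') :
    cube a ρ ⊆ cube b ρ' := fun x hx i => by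
  have h1 := abs_sub_le (x i) (a i) (b i)
  have h2 := h i
  have h3 := hx i
  linarith

theorem cube_mono (a : Rn n) {ρ ρ' : ℝ} (h : ρ ≤ ρ') : cube a ρ ⊆ cube a ρ' :=
  cube_subset_cube fun i => by simpa using h

theorem self_mem_cube (a : Rn n) {ρ : ℝ} (hρ : 0 ≤ ρ) : a ∈ cube a ρ := fun i => by simpa using hρ

theorem abs_sub_lt_subset_interior (a : Rn n) (ρ : ℝ) :
    {x | ∀ i, |x i - a i| < ρ} ⊆ interior (cube a ρ) := by
  refine interior_maximal (fun x hx i => (hx i).le) ?_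
  simp only [ofPred_forall]
  exact isOpen_iInter_of_finite fun i => isOpen_lt (by fun_prop) continuous_const

theorem cube_subset_interior (a : Rn n) {ρ ρ' : ℝ} (h : ρ < ρ') :
    cube a ρ ⊆ interior (cube a ρ') := fun _ hx =>
  abs_sub_lt_subset_interior a ρ' fun i => (hx i).trans_lt h

theorem interior_cube_nonempty (a : Rn n) {ρ : ℝ} (hρ : 0 < ρ) : (interior (cube a ρ)).Nonempty :=
  ⟨a, cube_subset_interior a hρ (self_mem_cube a le_rfl)⟩

theorem cube_mem_nhds (a : Rn n) {ρ : ℝ} (hρ : 0 < ρ) : cube a ρ ∈ nhds a :=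
  mem_interior_iff_mem_nhds.1 (cube_subset_interior a hρ (self_mem_cube a le_rfl))

theorem cube_subset_closedBall (a : Rn n) {ρ : ℝ} (hρ : 0 ≤ ρ) :
    cube a ρ ⊆ Metric.closedBall a (√n * ρ) := fun x hx => by
  rw [Metric.mem_closedBall, EuclideanSpace.dist_eq]
  refine Real.sqrt_le_iff.2 ⟨by positivity, ?_⟩
  calc ∑ i, dist (x i) (a i) ^ 2 ≤ ∑ _i : Fin n, ρ ^ 2 := by
        refine Finset.sum_le_sum fun i _ => ?_
        rw [Real.dist_eq]
        exact pow_le_pow_left₀ (abs_nonneg _) (hx i) 2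
    _ = (√n * ρ) ^ 2 := by simp [mul_pow]

theorem isCompact_cube (a : Rn n) (ρ : ℝ) : IsCompact (cube a ρ) := by
  refine Metric.isCompact_of_isClosed_isBounded (isClosed_cube a ρ) ?_
  exact (Metric.isBounded_closedBall (x := a) (r := √n * |ρ|)).subset
    ((cube_mono a (le_abs_self ρ)).trans (cube_subset_closedBall a (abs_nonneg ρ)))

theorem iUnion_cube_two_pow (a : Rn n) {ρ : ℝ} (hρ : 0 < ρ) (x : Rn n) :
    ∃ j : ℕ, x ∈ cube a (2 ^ j * ρ) := by
  obtain ⟨j, hj⟩ := pow_unbounded_of_one_lt (dist x a / ρ) (one_lt_two)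
  refine ⟨j, fun i => ?_⟩
  rw [div_lt_iff₀ hρ] at hj
  refine le_trans ?_ hj.le
  rw [dist_eq_norm]
  exact PiLp.norm_apply_le (x - a) i

end Cubes

/-! ### Distribution functions and layer-cake formulas -/

section LayerCake

variable {α : Type*} [MeasurableSpace α]

/-- The real-valued layer-cake formula covers functions finite almost everywhere. If the value `∞`
is taken on a set of positive measure, both sides are infinite, because `t^{κ-1}` is not integrable
on the half-line. Allowing `∞` spares a finiteness proof for maximal functions. -/
theorem lintegral_rpow_eq_lintegral_meas_lt {μ : Measure α} {F : α → ℝ≥0∞}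
    (hF : AEMeasurable F μ) {κ : ℝ} (hκ : 0 < κ) :
    ∫⁻ x, F x ^ κ ∂μ = ENNReal.ofReal κ *
      ∫⁻ t in Ioi (0 : ℝ), μ {x | ENNReal.ofReal t < F x} * ENNReal.ofReal (t ^ (κ - 1)) := by
  by_cases hfin : ∀ᵐ x ∂μ, F x ≠ ∞
  · have key := lintegral_rpow_eq_lintegral_meas_lt_mul (μ := μ) (f := fun x => (F x).toReal)
      (Filter.Eventually.of_forall fun x => ENNReal.toReal_nonneg) hF.ennreal_toReal hκ
    have h1 : ∫⁻ x, F x ^ κ ∂μ = ∫⁻ x, ENNReal.ofReal ((F x).toReal ^ κ) ∂μ := by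
      refine lintegral_congr_ae ?_
      filter_upwards [hfin] with x hx
      rw [← ENNReal.ofReal_rpow_of_nonneg ENNReal.toReal_nonneg hκ.le, ENNReal.ofReal_toReal hx]
    rw [h1, key]
    congr 1
    refine setLIntegral_congr_fun measurableSet_Ioi fun t ht => ?_
    congr 1
    refine measure_congr ?_
    filter_upwards [hfin] with x hx
    exact propext (ENNReal.ofReal_lt_iff_lt_toReal (le_of_lt ht) hx).symm
  · have hpos : μ {x | F x = ∞} ≠ 0 := by
      simpa [ae_iff] using hfin
    have hL : ∫⁻ x, F x ^ κ ∂μ = ∞ := by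
      by_contra h
      refine hpos (measure_mono_null ?_ (ae_iff.1 (ae_lt_top' (hF.pow_const κ) h)))
      intro x hx
      simp only [mem_ofPred_eq] at hx ⊢
      simp [hx, hκ]
    have hR : ∫⁻ t in Ioi (0 : ℝ),
        μ {x | ENNReal.ofReal t < F x} * ENNReal.ofReal (t ^ (κ - 1)) = ∞ := by
      have h2 : ∫⁻ t in Ioi (0 : ℝ), ENNReal.ofReal (t ^ (κ - 1)) = ∞ := by
        by_contra h
        have h3 : IntegrableOn (fun t : ℝ => t ^ (κ - 1)) (Ioi 0) := by
          refine ⟨by fun_prop, ?_⟩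
          rw [hasFiniteIntegral_iff_ofReal]
          · exact lt_top_iff_ne_top.2 h
          · filter_upwards [ae_restrict_mem measurableSet_Ioi] with t ht
            exact Real.rpow_nonneg (le_of_lt ht) _
        exact not_integrableOn_Ioi_rpow _ h3
      refine top_le_iff.1 ?_
      calc (∞ : ℝ≥0∞) = μ {x | F x = ∞} * ∫⁻ t in Ioi (0 : ℝ), ENNReal.ofReal (t ^ (κ - 1)) := by
            rw [h2, ENNReal.mul_top hpos]
        _ ≤ ∫⁻ t in Ioi (0 : ℝ), μ {x | F x = ∞} * ENNReal.ofReal (t ^ (κ - 1)) :=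
            lintegral_const_mul_le _ _
        _ ≤ _ := by
            refine lintegral_mono fun t => ?_
            gcongr with x
            intro hx
            simp [hx]
    rw [hL, hR, ENNReal.mul_top (by simpa using hκ)]

/-- A weak-type comparison of distribution functions yields a strong-type one. -/
theorem lintegral_rpow_le_of_meas_lt_le {μ ν : Measure α} {F G : α → ℝ≥0∞}
    (hF : AEMeasurable F μ) (hG : AEMeasurable G ν) {κ : ℝ} (hκ : 1 < κ) (C : ℝ≥0∞)
    (h : ∀ t : ℝ, 0 < t → μ {x | ENNReal.ofReal t < F x} * ENNReal.ofReal t ≤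
      C * ν {x | ENNReal.ofReal t < G x}) :
    ∫⁻ x, F x ^ κ ∂μ ≤ C * ENNReal.ofReal (κ / (κ - 1)) * ∫⁻ x, G x ^ (κ - 1) ∂ν := by
  have hκ1 : 0 < κ - 1 := by linarith
  rw [lintegral_rpow_eq_lintegral_meas_lt hF (by linarith),
    lintegral_rpow_eq_lintegral_meas_lt hG hκ1]
  have h1 : ∫⁻ t in Ioi (0 : ℝ), μ {x | ENNReal.ofReal t < F x} * ENNReal.ofReal (t ^ (κ - 1)) ≤
      ∫⁻ t in Ioi (0 : ℝ), C * (ν {x | ENNReal.ofReal t < G x} *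
        ENNReal.ofReal (t ^ (κ - 1 - 1))) := by
    refine setLIntegral_mono' measurableSet_Ioi fun t (ht : 0 < t) => ?_
    have : t ^ (κ - 1) = t * t ^ (κ - 1 - 1) := by
      rw [← Real.rpow_one_add' ht.le (by linarith)]
      congr 1; ring
    rw [this, ENNReal.ofReal_mul ht.le, ← mul_assoc, ← mul_assoc]
    exact mul_le_mul' (h t ht) le_rfl
  have hmeas : Measurable fun t : ℝ => ν {x | ENNReal.ofReal t < G x} *
      ENNReal.ofReal (t ^ (κ - 1 - 1)) := by
    refine Measurable.mul ?_ (by fun_prop)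
    refine Antitone.measurable fun s t hst => measure_mono fun _ (hx : ENNReal.ofReal t < G _) => ?_
    exact (ENNReal.ofReal_le_ofReal hst).trans_lt hx
  rw [lintegral_const_mul _ hmeas] at h1
  refine (mul_le_mul' le_rfl h1).trans_eq ?_
  rw [ENNReal.ofReal_div_of_pos hκ1, div_eq_mul_inv]
  have h3 : (ENNReal.ofReal (κ - 1))⁻¹ * ENNReal.ofReal (κ - 1) = 1 :=
    ENNReal.inv_mul_cancel (by simpa using hκ) ENNReal.ofReal_ne_top
  generalize ∫⁻ t in Ioi (0 : ℝ), ν {x | ENNReal.ofReal t < G x} *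
    ENNReal.ofReal (t ^ (κ - 1 - 1)) = I
  calc _ = C * ENNReal.ofReal κ * 1 * I := by ring
    _ = _ := by rw [← h3]; ring

end LayerCake

/-! ### Stopping-time selection of maximal cells -/

section Stopping

variable {X ι : Type*} [MeasurableSpace X] [Countable ι]

omit [MeasurableSpace X] [Countable ι] in
theorem eq_of_nested {D : ℕ → X → ι} (hD : ∀ k x y, D (k + 1) x = D (k + 1) y → D k x = D k y)
    {k : ℕ} {x y : X} (h : D k x = D k y) {j : ℕ} (hj : j ≤ k) : D j x = D j y := by
  induction k, hj using Nat.le_induction with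
  | base => exact h
  | succ k _ ih => exact ih (hD _ _ _ h)

/-- Comparison of two measures on the union of the cells with a property, from their comparison on
 the maximal ones. -/
theorem measure_le_of_stopping {D : ℕ → X → ι}
    (hD : ∀ k x y, D (k + 1) x = D (k + 1) y → D k x = D k y)
    (hmeas : ∀ k z, MeasurableSet (D k ⁻¹' {z})) (P : ℕ → ι → Prop) (ν μ : Measure X)
    (h : ∀ k x, P k (D k x) → (∀ j < k, ¬ P j (D j x)) →
      ν (D k ⁻¹' {D k x}) ≤ μ (D k ⁻¹' {D k x})) :
    ν {x | ∃ k, P k (D k x)} ≤ μ {x | ∃ k, P k (D k x)} := by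
  -- The points whose first generation with property `P` is the given one, sorted by their cell.
  -- Nestedness makes each such set empty or a full cell, and distinct ones are disjoint, so
  -- countable additivity applies.
  let T : ℕ × ι → Set X := fun q =>
    {x | D q.1 x = q.2 ∧ P q.1 (D q.1 x) ∧ ∀ j < q.1, ¬ P j (D j x)}
  have hT : ∀ q x, x ∈ T q → T q = D q.1 ⁻¹' {D q.1 x} := by
    rintro ⟨k, z⟩ x ⟨hx1, hx2, hx3⟩
    ext y
    simp only [T, mem_ofPred_eq, mem_preimage, mem_singleton_iff]
    refine ⟨fun hy => hy.1.trans hx1.symm, fun hy => ⟨hy.trans hx1, by rwa [hy], fun j hj => ?_⟩⟩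
    rw [eq_of_nested hD hy hj.le]
    exact hx3 j hj
  have hUnion : {x | ∃ k, P k (D k x)} = ⋃ q, T q := by
    classical
    ext x
    simp only [mem_ofPred_eq, mem_iUnion]
    constructor
    · intro hx
      exact ⟨(Nat.find hx, D (Nat.find hx) x), rfl, Nat.find_spec hx,
        fun j hj => Nat.find_min hx hj⟩
    · rintro ⟨q, hq⟩
      exact ⟨q.1, hq.2.1⟩
  have hTm : ∀ q, MeasurableSet (T q) := fun q => by
    rcases (T q).eq_empty_or_nonempty with h0 | ⟨x, hx⟩
    · rw [h0]; exact MeasurableSet.empty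
    · rw [hT q x hx]; exact hmeas _ _
  have hdisj : Pairwise (Function.onFun Disjoint T) := by
    rintro ⟨k, z⟩ ⟨k', z'⟩ hne
    refine Set.disjoint_left.2 ?_
    rintro x ⟨h1, h2, h3⟩ ⟨h1', h2', h3'⟩
    dsimp only at h1 h2 h3 h1' h2' h3'
    rcases lt_trichotomy k k' with hk | hk | hk
    · exact h3' _ hk h2
    · subst hk; exact hne (by rw [← h1, ← h1'])
    · exact h3 _ hk h2'
  rw [hUnion, measure_iUnion hdisj hTm, measure_iUnion hdisj hTm]
  refine ENNReal.tsum_le_tsum fun q => ?_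
  rcases (T q).eq_empty_or_nonempty with h0 | ⟨x, hx⟩
  · simp [h0]
  · rw [hT q x hx]
    exact h _ _ hx.2.1 hx.2.2

end Stopping

/-! ### Dyadic subcubes and a differentiation argument -/

section Dyadic

variable {n : ℕ}

/-- The index of the dyadic subcube of generation `k` containing `x`, relative to the cube with
centre `a` and side-length `2 * ρ`. -/
noncomputable def dyadicIndex (a : Rn n) (ρ : ℝ) (k : ℕ) (x : Rn n) : Fin n → ℤ :=
  fun i => ⌊2 ^ k * ((x i - a i + ρ) / (2 * ρ))⌋

/-- The half-open dyadic cube of generation `k` and index `z`. -/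
def dyadicCell (a : Rn n) (ρ : ℝ) (k : ℕ) (z : Fin n → ℤ) : Set (Rn n) :=
  dyadicIndex a ρ k ⁻¹' {z}

/-- The centre of a dyadic cube. -/
noncomputable def dyadicCenter (a : Rn n) (ρ : ℝ) (k : ℕ) (z : Fin n → ℤ) : Rn n :=
  WithLp.toLp 2 fun i => a i - ρ + ρ / 2 ^ k * (2 * z i + 1)

theorem dyadicIndex_nested (a : Rn n) (ρ : ℝ) (k : ℕ) (x y : Rn n)
    (h : dyadicIndex a ρ (k + 1) x = dyadicIndex a ρ (k + 1) y) :
    dyadicIndex a ρ k x = dyadicIndex a ρ k y := by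
  have key : ∀ s t : ℝ, ⌊2 * s⌋ = ⌊2 * t⌋ → ⌊s⌋ = ⌊t⌋ := by
    have half : ∀ s : ℝ, ⌊s⌋ = ⌊2 * s⌋ / 2 := fun s => by
      have h1 := Int.floor_div_natCast (2 * s) 2
      rw [show 2 * s / ((2 : ℕ) : ℝ) = s by push_cast; ring] at h1
      exact h1
    intro s t hst
    rw [half s, half t, hst]
  funext i
  have hi := congrFun h i
  simp only [dyadicIndex, pow_succ', mul_assoc] at hi ⊢
  exact key _ _ hi

theorem dyadicCell_eq_preimage (a : Rn n) {ρ : ℝ} (hρ : 0 < ρ) (k : ℕ) (z : Fin n → ℤ) :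
    dyadicCell a ρ k z = WithLp.ofLp ⁻¹' Set.pi univ fun i =>
      Ico (a i - ρ + 2 * (ρ / 2 ^ k) * z i) (a i - ρ + 2 * (ρ / 2 ^ k) * (z i + 1)) := by
  ext x
  simp only [dyadicCell, mem_preimage, mem_singleton_iff, mem_pi, mem_univ, true_imp_iff, mem_Ico,
    funext_iff, dyadicIndex, Int.floor_eq_iff]
  refine forall_congr' fun i => ?_
  have hk : (0 : ℝ) < 2 ^ k := by positivity
  have e : 2 ^ k * ((x i - a i + ρ) / (2 * ρ)) = (x i - a i + ρ) / (2 * (ρ / 2 ^ k)) := by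
    field_simp
  rw [e, le_div_iff₀ (by positivity), div_lt_iff₀ (by positivity)]
  constructor
  · rintro ⟨h1, h2⟩
    constructor <;> linarith
  · rintro ⟨h1, h2⟩
    constructor <;> linarith

theorem measurableSet_dyadicCell (a : Rn n) {ρ : ℝ} (hρ : 0 < ρ) (k : ℕ) (z : Fin n → ℤ) :
    MeasurableSet (dyadicCell a ρ k z) := by
  rw [dyadicCell_eq_preimage a hρ]
  exact (MeasurableSet.univ_pi fun _ => measurableSet_Ico).preimage (by fun_prop)

theorem dyadicCell_subset_cube (a : Rn n) {ρ : ℝ} (hρ : 0 < ρ) (k : ℕ) (z : Fin n → ℤ) :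
    dyadicCell a ρ k z ⊆ cube (dyadicCenter a ρ k z) (ρ / 2 ^ k) := by
  rw [dyadicCell_eq_preimage a hρ]
  intro x hx i
  have h := hx i (mem_univ i)
  simp only [mem_Ico] at h
  simp only [dyadicCenter]
  rw [abs_le]
  constructor <;> linarith [h.1, h.2]

theorem volume_dyadicCell (a : Rn n) {ρ : ℝ} (hρ : 0 < ρ) (k : ℕ) (z : Fin n → ℤ) :
    volume (dyadicCell a ρ k z) = ENNReal.ofReal (2 * (ρ / 2 ^ k)) ^ n := by
  rw [dyadicCell_eq_preimage a hρ, (PiLp.volume_preserving_ofLp (Fin n)).measure_preimage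
    (MeasurableSet.univ_pi fun _ => measurableSet_Ico).nullMeasurableSet, Real.volume_pi_Ico]
  simp [mul_add]

theorem dyadicCell_ae_eq_cube (a : Rn n) {ρ : ℝ} (hρ : 0 < ρ) (k : ℕ) (z : Fin n → ℤ) :
    dyadicCell a ρ k z =ᵐ[volume] cube (dyadicCenter a ρ k z) (ρ / 2 ^ k) := by
  refine ae_eq_of_subset_of_measure_ge (dyadicCell_subset_cube a hρ k z) ?_
    (measurableSet_dyadicCell a hρ k z).nullMeasurableSet (volume_cube_lt_top _ _).ne
  rw [volume_cube, volume_dyadicCell a hρ]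

theorem dyadicCell_zero_ae_eq (a : Rn n) {ρ : ℝ} (hρ : 0 < ρ) :
    dyadicCell a ρ 0 0 =ᵐ[volume] cube a ρ := by
  have h := dyadicCell_ae_eq_cube a hρ 0 0
  have hc : dyadicCenter a ρ 0 0 = a := by
    ext i
    simp [dyadicCenter]
  rwa [hc, pow_zero, div_one] at h

theorem exists_dyadicCell_subset (a : Rn n) {ρ : ℝ} (hρ : 0 < ρ) {U : Set (Rn n)} (hU : IsOpen U)
    {x : Rn n} (hx : x ∈ U) : ∃ k, dyadicCell a ρ k (dyadicIndex a ρ k x) ⊆ U := by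
  obtain ⟨ε, hε, hb⟩ := Metric.isOpen_iff.1 hU x hx
  obtain ⟨k, hk⟩ := pow_unbounded_of_one_lt (√n * (2 * ρ) / ε) (one_lt_two (α := ℝ))
  refine ⟨k, fun y hy => hb ?_⟩
  have hk0 : (0 : ℝ) < 2 ^ k := by positivity
  have hxy : y ∈ cube x (2 * ρ / 2 ^ k) := fun i => by
    have h1 := dyadicCell_subset_cube a hρ k _ hy i
    have h2 := dyadicCell_subset_cube a hρ k (dyadicIndex a ρ k x) (rfl : x ∈ _) i
    rw [abs_sub_comm] at h2
    have h3 := abs_sub_le (y i) ((dyadicCenter a ρ k (dyadicIndex a ρ k x)) i) (x i)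
    have : 2 * ρ / 2 ^ k = ρ / 2 ^ k + ρ / 2 ^ k := by ring
    linarith
  have h4 := cube_subset_closedBall x (by positivity) hxy
  rw [Metric.mem_closedBall] at h4
  rw [Metric.mem_ball]
  refine h4.trans_lt ?_
  rw [div_lt_iff₀ hε] at hk
  rw [← mul_div_assoc, div_lt_iff₀ hk0]
  linarith

/-- Replaces the Lebesgue differentiation theorem. If the integral of `w` over a part of `A`
exceeded `l` times its measure, the same would hold with the measure of a slightly larger open set
`U`. The maximal cells inside `U` with average at most `l` cover that part, and summing over them
gives a contradiction. -/
theorem ae_le_of_dyadicCell (a : Rn n) {ρ : ℝ} (hρ : 0 < ρ) {w : Rn n → ℝ≥0∞} (hw : Measurable w)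
    {l : ℝ≥0∞} (hl0 : l ≠ 0) (hl : l ≠ ∞) {A : Set (Rn n)} (hA : MeasurableSet A)
    (h : ∀ x ∈ A, ∀ k, wMeas w (dyadicCell a ρ k (dyadicIndex a ρ k x)) ≤
      l * volume (dyadicCell a ρ k (dyadicIndex a ρ k x))) :
    ∀ᵐ x ∂volume.restrict A, w x ≤ l := by
  refine ae_le_of_forall_setLIntegral_le_of_sigmaFinite hw fun s hs _ => ?_
  rw [Measure.restrict_restrict hs, setLIntegral_const]
  by_contra! hlt
  have h1 : volume (s ∩ A) < (∫⁻ x in s ∩ A, w x) / l := by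
    rw [ENNReal.lt_div_iff_mul_lt (Or.inl hl0) (Or.inl hl), mul_comm]
    exact hlt
  obtain ⟨U, hU, hUo, hUl⟩ := Set.exists_isOpen_lt_of_lt _ _ h1
  rw [ENNReal.lt_div_iff_mul_lt (Or.inl hl0) (Or.inl hl)] at hUl
  refine absurd hUl (not_lt.2 ?_)
  let P : ℕ → (Fin n → ℤ) → Prop := fun k z =>
    dyadicCell a ρ k z ⊆ U ∧ wMeas w (dyadicCell a ρ k z) ≤ l * volume (dyadicCell a ρ k z)
  have key := measure_le_of_stopping (dyadicIndex_nested a ρ)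
    (fun k z => measurableSet_dyadicCell a hρ k z) P (volume.withDensity w) (l • volume)
    (fun k x hP _ => by
      have := hP.2
      change volume.withDensity w (dyadicCell a ρ k _) ≤ (l • volume) (dyadicCell a ρ k _)
      rw [withDensity_apply _ (measurableSet_dyadicCell a hρ k _)]
      simpa [wMeas] using this)
  have hsub : s ∩ A ⊆ {x | ∃ k, P k (dyadicIndex a ρ k x)} := fun x hx => by
    obtain ⟨k, hk⟩ := exists_dyadicCell_subset a hρ hUo (hU hx)
    exact ⟨k, hk, h x hx.2 k⟩
  have hsub' : {x | ∃ k, P k (dyadicIndex a ρ k x)} ⊆ U := by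
    rintro x ⟨k, hk⟩
    exact hk.1 rfl
  calc ∫⁻ x in s ∩ A, w x = volume.withDensity w (s ∩ A) :=
        (withDensity_apply _ (hs.inter hA)).symm
    _ ≤ _ := measure_mono hsub
    _ ≤ _ := key
    _ ≤ (l • volume) U := measure_mono hsub'
    _ = volume U * l := by simp [mul_comm]

end Dyadic

/-! ### Hölder's inequality between dual weighted spaces -/

section WeightedHolder

variable {α : Type*} [MeasurableSpace α] {μ : Measure α} {w : α → ℝ≥0∞}

/-- Hölder's inequality after inserting `w^{1/t} w^{-1/t}`. The exponent `-(t-1)⁻¹` is `1 - t'`, so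
the second factor is the norm in the space dual to `L_t(w)`. -/
theorem lintegral_mul_le_weighted (hw : AEMeasurable w μ) (hw0 : ∀ᵐ x ∂μ, 0 < w x)
    (hwt : ∀ᵐ x ∂μ, w x < ∞) {t : ℝ} (ht : 1 < t) {F G : α → ℝ≥0∞} (hF : AEMeasurable F μ)
    (hG : AEMeasurable G μ) :
    ∫⁻ x, G x * F x ∂μ ≤ (∫⁻ x, G x ^ t * w x ∂μ) ^ (1 / t) *
      (∫⁻ x, F x ^ (t / (t - 1)) * w x ^ (-(t - 1)⁻¹) ∂μ) ^ ((t - 1) / t) := by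
  have ht0 : 0 < t := by linarith
  have ht1 : 0 < t - 1 := by linarith
  have hpq : t.HolderConjugate (t / (t - 1)) := Real.HolderConjugate.conjExponent ht
  have key := ENNReal.lintegral_mul_le_Lp_mul_Lq μ hpq (hG.mul (hw.pow_const (1 / t)))
    (hF.mul (hw.pow_const (-(1 / t))))
  refine (lintegral_mono_ae ?_).trans (key.trans_eq ?_)
  · filter_upwards [hw0, hwt] with x h0 h1
    simp only [Pi.mul_apply]
    rw [mul_mul_mul_comm, ← ENNReal.rpow_add _ _ h0.ne' h1.ne]
    simp
  · congr 1
    · congr 1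
      refine lintegral_congr fun x => ?_
      simp only [Pi.mul_apply]
      rw [ENNReal.mul_rpow_of_nonneg _ _ ht0.le, ← ENNReal.rpow_mul]
      simp [ht0.ne']
    · rw [one_div_div]
      congr 1
      refine lintegral_congr fun x => ?_
      simp only [Pi.mul_apply]
      rw [ENNReal.mul_rpow_of_nonneg _ _ hpq.symm.nonneg, ← ENNReal.rpow_mul]
      congr 2
      field_simp

theorem lintegral_rpow_le_weighted (hw : AEMeasurable w μ) (hw0 : ∀ᵐ x ∂μ, 0 < w x)
    (hwt : ∀ᵐ x ∂μ, w x < ∞) {t : ℝ} (ht : 1 < t) {G : α → ℝ≥0∞} (hG : AEMeasurable G μ) :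
    (∫⁻ x, G x ∂μ) ^ t ≤
      (∫⁻ x, G x ^ t * w x ∂μ) * (∫⁻ x, w x ^ (-(t - 1)⁻¹) ∂μ) ^ (t - 1) := by
  have ht0 : 0 < t := by linarith
  have key := lintegral_mul_le_weighted hw hw0 hwt ht (F := fun _ => 1) aemeasurable_const hG
  simp only [mul_one, ENNReal.one_rpow, one_mul] at key
  refine (ENNReal.rpow_le_rpow key ht0.le).trans_eq ?_
  rw [ENNReal.mul_rpow_of_nonneg _ _ ht0.le, ← ENNReal.rpow_mul, ← ENNReal.rpow_mul,
    one_div_mul_cancel ht0.ne', div_mul_cancel₀ _ ht0.ne', ENNReal.rpow_one]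

end WeightedHolder

/-! ### The Muckenhoupt condition and its consequences on a single cube -/

section Muckenhoupt

variable {n : ℕ}

/-- The Muckenhoupt condition `A_t`, with finite values and without quotients. -/
structure IsMuckenhoupt (t : ℝ) (w : Rn n → ℝ≥0∞) : Prop where
  aemeasurable : AEMeasurable w volume
  pos : ∀ᵐ x, 0 < w x
  lt_top : ∀ᵐ x, w x < ∞
  wMeas_lt_top : ∀ a ρ, wMeas w (cube a ρ) < ∞
  bound : ∃ C : ℝ≥0, ∀ (a : Rn n) (ρ : ℝ), 0 < ρ →
    wMeas w (cube a ρ) * wMeas (fun x => w x ^ (-(t - 1)⁻¹)) (cube a ρ) ^ (t - 1) ≤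
      C * volume (cube a ρ) ^ t

theorem wMeas_congr {w w' : Rn n → ℝ≥0∞} (h : w =ᵐ[volume] w') (S : Set (Rn n)) :
    wMeas w S = wMeas w' S := lintegral_congr_ae (ae_restrict_of_ae h)

theorem wMeas_mono (w : Rn n → ℝ≥0∞) {S T : Set (Rn n)} (h : S ⊆ T) : wMeas w S ≤ wMeas w T :=
  lintegral_mono_set h

theorem IsMuckenhoupt.congr {t : ℝ} {w w' : Rn n → ℝ≥0∞} (hw : IsMuckenhoupt t w)
    (h : w =ᵐ[volume] w') : IsMuckenhoupt t w' where
  aemeasurable := hw.aemeasurable.congr h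
  pos := by filter_upwards [h, hw.pos] with x h1 h2; rwa [← h1]
  lt_top := by filter_upwards [h, hw.lt_top] with x h1 h2; rwa [← h1]
  wMeas_lt_top a ρ := by rw [← wMeas_congr h]; exact hw.wMeas_lt_top a ρ
  bound := by
    obtain ⟨C, hC⟩ := hw.bound
    refine ⟨C, fun a ρ hρ => ?_⟩
    have h' : (fun x => w x ^ (-(t - 1)⁻¹)) =ᵐ[volume] fun x => w' x ^ (-(t - 1)⁻¹) := by
      filter_upwards [h] with x h1
      rw [h1]
    rw [← wMeas_congr h, ← wMeas_congr h']
    exact hC a ρ hρ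

theorem wMeas_cube_pos {w : Rn n → ℝ≥0∞} (hw : AEMeasurable w volume) (h : ∀ᵐ x, 0 < w x)
    (a : Rn n) {ρ : ℝ} (hρ : 0 < ρ) : 0 < wMeas w (cube a ρ) := by
  rw [wMeas, pos_iff_ne_zero, Ne, lintegral_eq_zero_iff' hw.restrict]
  intro h0
  have : volume.restrict (cube a ρ) univ = 0 := by
    refine measure_mono_null ?_ (ae_iff.1 ((ae_restrict_of_ae (s := cube a ρ) h).and h0))
    intro x _ hx
    exact hx.1.ne' hx.2
  rw [Measure.restrict_apply_univ] at this
  exact (volume_cube_pos a hρ).ne' this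

theorem IsMuckenhoupt.wMeas_pos {t : ℝ} {w : Rn n → ℝ≥0∞} (hw : IsMuckenhoupt t w)
    (a : Rn n) {ρ : ℝ} (hρ : 0 < ρ) : 0 < wMeas w (cube a ρ) :=
  wMeas_cube_pos hw.aemeasurable hw.pos a hρ

/-- The form in which the condition is applied: averages are controlled by weighted `L_t` averages.
Indicator functions as `G` yield doubling and the comparison of measures of subsets; general `G`
yields the pointwise bound for the maximal function. -/
theorem IsMuckenhoupt.lintegral_rpow_mul_le {t : ℝ} (ht : 1 < t) {w : Rn n → ℝ≥0∞}
    (hw : IsMuckenhoupt t w) : ∃ C : ℝ≥0, ∀ (a : Rn n) (ρ : ℝ), 0 < ρ → ∀ G : Rn n → ℝ≥0∞,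
      AEMeasurable G volume → (∫⁻ x in cube a ρ, G x) ^ t * wMeas w (cube a ρ) ≤
        C * volume (cube a ρ) ^ t * ∫⁻ x in cube a ρ, G x ^ t * w x := by
  obtain ⟨C, hC⟩ := hw.bound
  refine ⟨C, fun a ρ hρ G hG => ?_⟩
  have h1 := lintegral_rpow_le_weighted (μ := volume.restrict (cube a ρ)) hw.aemeasurable.restrict
    (ae_restrict_of_ae hw.pos) (ae_restrict_of_ae hw.lt_top) ht hG.restrict
  calc _ ≤ (∫⁻ x in cube a ρ, G x ^ t * w x) *
        (∫⁻ x in cube a ρ, w x ^ (-(t - 1)⁻¹)) ^ (t - 1) * wMeas w (cube a ρ) := by gcongr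
    _ = (∫⁻ x in cube a ρ, G x ^ t * w x) * (wMeas w (cube a ρ) *
        wMeas (fun x => w x ^ (-(t - 1)⁻¹)) (cube a ρ) ^ (t - 1)) := by
          simp only [wMeas]; ring
    _ ≤ (∫⁻ x in cube a ρ, G x ^ t * w x) * (C * volume (cube a ρ) ^ t) := by
          exact mul_le_mul' le_rfl (hC a ρ hρ)
    _ = _ := by ring

/-- Let `E` be the part of the cube `Q` where `w ≤ θl`. Testing the Muckenhoupt condition with the
indicator of `E` gives `(|E|/|Q|)^{t-1} ≤ Cθ`, so for small `θ` the set `E` occupies at most half of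
`Q`. -/
theorem IsMuckenhoupt.exists_volume_le {t : ℝ} (ht : 1 < t) {w : Rn n → ℝ≥0∞}
    (hw : IsMuckenhoupt t w) (hwm : Measurable w) : ∃ θ : ℝ, 0 < θ ∧ θ ≤ 1 ∧
      ∀ (a : Rn n) (ρ : ℝ), 0 < ρ → ∀ l : ℝ, 0 < l →
      ENNReal.ofReal l * volume (cube a ρ) ≤ wMeas w (cube a ρ) →
      volume (cube a ρ) ≤ 2 * volume (cube a ρ ∩ {x | ENNReal.ofReal (θ * l) < w x}) := by
  obtain ⟨C, hC⟩ := hw.lintegral_rpow_mul_le ht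
  have ht1 : 0 < t - 1 := by linarith
  have hhalf : (0 : ℝ) < (1 / 2) ^ (t - 1) := by positivity
  have hhalf1 : (1 / 2 : ℝ) ^ (t - 1) ≤ 1 :=
    Real.rpow_le_one (by norm_num) (by norm_num) ht1.le
  -- The summand `1` gives the strict inequality `Cθ < (1/2)^{t-1}` and also `θ ≤ 1`.
  set θ : ℝ := (1 / 2) ^ (t - 1) / (C + 1) with hθ
  have hC1 : (0 : ℝ) < C + 1 := by positivity
  have hθ0 : 0 < θ := by positivity
  have hCθ : C * θ < (1 / 2) ^ (t - 1) := by
    rw [hθ, mul_div_assoc', div_lt_iff₀ hC1]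
    nlinarith
  refine ⟨θ, hθ0, ?_, fun a ρ hρ l hl hle => ?_⟩
  · rw [hθ, div_le_one hC1]
    exact hhalf1.trans (by linarith [C.coe_nonneg])
  set Q := cube a ρ with hQ
  have hQm : MeasurableSet Q := measurableSet_cube a ρ
  set B := {x | ENNReal.ofReal (θ * l) < w x} with hB
  have hBm : MeasurableSet B := measurableSet_lt measurable_const hwm
  have hV0 : volume Q ≠ 0 := (volume_cube_pos a hρ).ne'
  have hVt : volume Q ≠ ∞ := (volume_cube_lt_top a ρ).ne
  by_contra! hlt
  set E := Q \ B with hE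
  have hEt : volume E ≠ ∞ := measure_ne_top_of_subset sdiff_subset hVt
  have hsplit : volume (Q ∩ B) + volume E = volume Q := measure_inter_add_sdiff Q hBm
  have hQBt : volume (Q ∩ B) ≠ ∞ := measure_ne_top_of_subset inter_subset_left hVt
  have key := hC a ρ hρ (E.indicator 1) (by
    exact (measurable_one.indicator (hQm.diff hBm)).aemeasurable)
  have e1 : ∫⁻ x in Q, E.indicator (1 : Rn n → ℝ≥0∞) x = volume E := by
    rw [lintegral_indicator_one (hQm.diff hBm), Measure.restrict_apply (hQm.diff hBm),
      inter_eq_left.2 sdiff_subset]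
  have e2 : ∫⁻ x in Q, E.indicator (1 : Rn n → ℝ≥0∞) x ^ t * w x ≤
      ENNReal.ofReal (θ * l) * volume E := by
    calc _ ≤ ∫⁻ x in Q, E.indicator (fun _ => ENNReal.ofReal (θ * l)) x := by
          refine lintegral_mono fun x => ?_
          by_cases hx : x ∈ E
          · simpa [hx, hB] using hx.2
          · simp [hx, ht.trans' one_pos]
      _ = _ := by
          rw [lintegral_indicator_const (hQm.diff hBm), Measure.restrict_apply (hQm.diff hBm),
            inter_eq_left.2 sdiff_subset]
  rw [← hQ, e1] at key
  have key2 : volume E ^ t * (ENNReal.ofReal l * volume Q) ≤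
      C * volume Q ^ t * (ENNReal.ofReal (θ * l) * volume E) :=
    (mul_le_mul' le_rfl hle).trans (key.trans (mul_le_mul' le_rfl e2))
  have hsplit' := congrArg ENNReal.toReal hsplit
  rw [ENNReal.toReal_add hQBt hEt] at hsplit'
  have hlt' := (ENNReal.toReal_lt_toReal (ENNReal.mul_ne_top (by simp) hQBt) hVt).2 hlt
  have key3 := ENNReal.toReal_mono (by finiteness) key2
  have hv : 0 < (volume Q).toReal := ENNReal.toReal_pos hV0 hVt
  simp only [ENNReal.toReal_mul, ENNReal.toReal_ofNat, ← ENNReal.toReal_rpow,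
    ENNReal.toReal_ofReal hl.le, ENNReal.toReal_ofReal (mul_pos hθ0 hl).le,
    ENNReal.coe_toReal] at hlt' key3
  set v := (volume Q).toReal
  set e := (volume E).toReal
  have he : v / 2 < e := by linarith
  have he0 : 0 < e := by linarith [half_pos hv]
  have r1 : e ^ t = e * e ^ (t - 1) := by
    rw [← Real.rpow_one_add' he0.le (by linarith)]; congr 1; ring
  have r2 : v ^ t = v * v ^ (t - 1) := by
    rw [← Real.rpow_one_add' hv.le (by linarith)]; congr 1; ring
  rw [r1, r2] at key3
  have key4 : e ^ (t - 1) ≤ C * θ * v ^ (t - 1) := by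
    have hp : 0 < e * l * v := by positivity
    refine le_of_mul_le_mul_left ?_ hp
    linarith
  have key5 : (v / 2) ^ (t - 1) ≤ e ^ (t - 1) := Real.rpow_le_rpow (by positivity) he.le ht1.le
  have key6 : (v / 2) ^ (t - 1) = (1 / 2) ^ (t - 1) * v ^ (t - 1) := by
    rw [← Real.mul_rpow (by norm_num) hv.le]; congr 1; ring
  have hvp : 0 < v ^ (t - 1) := Real.rpow_pos_of_pos hv _
  nlinarith

end Muckenhoupt

/-! ### Reverse Hölder inequality for Muckenhoupt weights -/

section ReverseHolder

variable {n : ℕ}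

theorem volume_dyadicCell_succ (a : Rn n) {ρ : ℝ} (hρ : 0 < ρ) (k : ℕ) (z z' : Fin n → ℤ) :
    volume (dyadicCell a ρ k z) = 2 ^ n * volume (dyadicCell a ρ (k + 1) z') := by
  rw [volume_dyadicCell a hρ, volume_dyadicCell a hρ, ← mul_pow]
  congr 1
  rw [show (2 : ℝ≥0∞) = ENNReal.ofReal 2 by simp, ← ENNReal.ofReal_mul (by norm_num)]
  congr 1
  rw [pow_succ]
  field_simp

/-- The Calderón-Zygmund decomposition of a cube, combined with the fact that a Muckenhoupt weight
is comparable with its average on a large part of each cube. -/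
theorem setLIntegral_superlevel_le {w : Rn n → ℝ≥0∞} (hwm : Measurable w) {θ : ℝ}
    (hθ : ∀ (a : Rn n) (ρ : ℝ), 0 < ρ → ∀ l : ℝ, 0 < l →
      ENNReal.ofReal l * volume (cube a ρ) ≤ wMeas w (cube a ρ) →
      volume (cube a ρ) ≤ 2 * volume (cube a ρ ∩ {x | ENNReal.ofReal (θ * l) < w x}))
    (a : Rn n) {ρ : ℝ} (hρ : 0 < ρ) {l : ℝ} (hl : 0 < l)
    (hroot : wMeas w (cube a ρ) ≤ ENNReal.ofReal l * volume (cube a ρ)) :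
    volume.withDensity w (cube a ρ ∩ {x | ENNReal.ofReal l < w x}) ≤
      2 ^ (n + 1) * ENNReal.ofReal l *
        volume (cube a ρ ∩ {x | ENNReal.ofReal (θ * l) < w x}) := by
  have hac : volume.withDensity w ≪ volume := withDensity_absolutelyContinuous _ _
  set ν := volume.withDensity w with hν
  set B := {x | ENNReal.ofReal (θ * l) < w x} with hB
  set R := dyadicCell a ρ 0 0 with hR
  have hRm : MeasurableSet R := measurableSet_dyadicCell a hρ 0 0
  have hRQ : R =ᵐ[volume] cube a ρ := dyadicCell_zero_ae_eq a hρ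
  have hνw : ∀ S, MeasurableSet S → ν S = wMeas w S := fun S hS => withDensity_apply _ hS
  let P : ℕ → (Fin n → ℤ) → Prop := fun k z => dyadicCell a ρ k z ⊆ R ∧
    ENNReal.ofReal l * volume (dyadicCell a ρ k z) < wMeas w (dyadicCell a ρ k z)
  set S := {x | ∃ k, P k (dyadicIndex a ρ k x)} with hS
  have hSR : S ⊆ R := by
    rintro x ⟨k, hk⟩
    exact hk.1 rfl
  have hSm : MeasurableSet S := by
    have : S = ⋃ (k : ℕ) (z : Fin n → ℤ) (_ : P k z), dyadicCell a ρ k z := by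
      ext x
      simp [hS, dyadicCell]
    rw [this]
    exact MeasurableSet.iUnion fun k => MeasurableSet.iUnion fun z => MeasurableSet.iUnion
      fun _ => measurableSet_dyadicCell a hρ k z
  have hwR : wMeas w R ≤ ENNReal.ofReal l * volume R := by
    rw [measure_congr hRQ, wMeas, setLIntegral_congr hRQ]
    exact hroot
  have hsubR : ∀ x ∈ R, ∀ k, dyadicCell a ρ k (dyadicIndex a ρ k x) ⊆ R := fun x hx k y hy =>
    (eq_of_nested (dyadicIndex_nested a ρ) hy (Nat.zero_le k)).trans hx
  have key := measure_le_of_stopping (dyadicIndex_nested a ρ)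
    (fun k z => measurableSet_dyadicCell a hρ k z) P ν
    ((2 ^ (n + 1) * ENNReal.ofReal l) • volume.restrict B) (fun k x hP hmax => by
      change ν (dyadicCell a ρ k _) ≤
        (2 ^ (n + 1) * ENNReal.ofReal l) • (volume.restrict B) (dyadicCell a ρ k _)
      have hxR : x ∈ R := hP.1 rfl
      -- The root is never selected, since its average is at most `l`. Any other selected cell has
      -- an unselected parent, so its `w`-mass is at most `2^n l` times its volume, and at least
      -- half of the cell lies in `B`.
      cases k with
      | zero =>
        have h0 : dyadicIndex a ρ 0 x = 0 := hxR
        have h1 := hP.2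
        rw [h0] at h1
        exact absurd hwR (not_le.2 h1)
      | succ k =>
        set z := dyadicIndex a ρ (k + 1) x with hz
        set z' := dyadicIndex a ρ k x with hz'
        have hpar : wMeas w (dyadicCell a ρ k z') ≤
            ENNReal.ofReal l * volume (dyadicCell a ρ k z') := by
          by_contra! hlt
          exact hmax k (Nat.lt_succ_self k) ⟨hsubR x hxR k, hlt⟩
        have hsub : dyadicCell a ρ (k + 1) z ⊆ dyadicCell a ρ k z' := fun y hy =>
          dyadicIndex_nested a ρ k y x hy
        have hae := dyadicCell_ae_eq_cube a hρ (k + 1) z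
        have hhalf : volume (dyadicCell a ρ (k + 1) z) ≤
            2 * volume (dyadicCell a ρ (k + 1) z ∩ B) := by
          have h2 := hP.2.le
          rw [measure_congr hae, wMeas, setLIntegral_congr hae] at h2
          have h3 := hθ _ _ (by positivity) l hl h2
          rw [measure_congr hae, measure_congr (hae.inter (ae_eq_refl B))]
          exact h3
        rw [hνw _ (measurableSet_dyadicCell a hρ _ _), smul_eq_mul,
          Measure.restrict_apply (measurableSet_dyadicCell a hρ _ _)]
        calc wMeas w (dyadicCell a ρ (k + 1) z) ≤ wMeas w (dyadicCell a ρ k z') :=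
              wMeas_mono w hsub
          _ ≤ ENNReal.ofReal l * volume (dyadicCell a ρ k z') := hpar
          _ = ENNReal.ofReal l * (2 ^ n * volume (dyadicCell a ρ (k + 1) z)) := by
              rw [volume_dyadicCell_succ a hρ k z' z]
          _ ≤ ENNReal.ofReal l * (2 ^ n * (2 * volume (dyadicCell a ρ (k + 1) z ∩ B))) := by
              gcongr
          _ = _ := by ring)
  -- Outside the selected cells all dyadic averages are at most `l`, hence so is `w` almost
  -- everywhere.
  have hnull : volume ((R ∩ {x | ENNReal.ofReal l < w x}) \ S) = 0 := by
    have h1 := ae_le_of_dyadicCell a hρ hwm (l := ENNReal.ofReal l) (by simpa using hl) (by simp)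
      (hRm.diff hSm) (fun x hx k => by
        by_contra! hlt
        exact hx.2 ⟨k, hsubR x hx.1 k, hlt⟩)
    rw [ae_restrict_iff' (hRm.diff hSm)] at h1
    refine measure_mono_null ?_ (ae_iff.1 h1)
    rintro x ⟨⟨hx1, hx2⟩, hx3⟩ hx
    exact absurd (hx ⟨hx1, hx3⟩) (not_le.2 hx2)
  calc ν (cube a ρ ∩ {x | ENNReal.ofReal l < w x})
      = ν (R ∩ {x | ENNReal.ofReal l < w x}) :=
        measure_congr ((hac.ae_eq hRQ.symm).inter (ae_eq_refl _))
    _ ≤ ν ((R ∩ {x | ENNReal.ofReal l < w x}) \ S ∪ S) :=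
        measure_mono (by rw [sdiff_union_self]; exact subset_union_left)
    _ ≤ ν ((R ∩ {x | ENNReal.ofReal l < w x}) \ S) + ν S := measure_union_le _ _
    _ = ν S := by rw [hac hnull, zero_add]
    _ ≤ _ := key
    _ = 2 ^ (n + 1) * ENNReal.ofReal l * volume (S ∩ B) := by
        rw [Measure.smul_apply, Measure.restrict_apply hSm, smul_eq_mul]
    _ ≤ 2 ^ (n + 1) * ENNReal.ofReal l * volume (R ∩ B) := by gcongr
    _ = _ := by rw [measure_congr (hRQ.inter (ae_eq_refl B))]

/-- Integration of the level-set inequality against `δ t^{δ-1} dt`. The last term produces `δ/(1+δ)`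
times the integral of `G^{1+δ}`; only the factor `δ` is kept, whose smallness later permits
absorption. -/
theorem lintegral_rpow_le_of_meas_lt_le_add {α : Type*} [MeasurableSpace α] {μ ν : Measure α}
    {F G H : α → ℝ≥0∞} (hF : AEMeasurable F ν) (hH : AEMeasurable H ν) (hG : AEMeasurable G μ)
    {δ : ℝ} (hδ : 0 < δ) (C : ℝ≥0∞)
    (h : ∀ t : ℝ, 0 < t → ν {x | ENNReal.ofReal t < F x} ≤ ν {x | ENNReal.ofReal t < H x} +
      C * ENNReal.ofReal t * μ {x | ENNReal.ofReal t < G x}) :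
    ∫⁻ x, F x ^ δ ∂ν ≤ ∫⁻ x, H x ^ δ ∂ν + C * ENNReal.ofReal δ * ∫⁻ x, G x ^ (1 + δ) ∂μ := by
  rw [lintegral_rpow_eq_lintegral_meas_lt hF hδ, lintegral_rpow_eq_lintegral_meas_lt hH hδ,
    lintegral_rpow_eq_lintegral_meas_lt hG (by linarith : 0 < 1 + δ)]
  have hmono : ∀ (μ : Measure α) (G : α → ℝ≥0∞), Measurable fun t : ℝ =>
      μ {x | ENNReal.ofReal t < G x} := fun μ G => Antitone.measurable fun s t hst =>
    measure_mono fun x (hx : ENNReal.ofReal t < G x) => (ENNReal.ofReal_le_ofReal hst).trans_lt hx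
  have hrpow : ∀ κ : ℝ, Measurable fun t : ℝ => ENNReal.ofReal (t ^ κ) := fun κ => by fun_prop
  have h1 : ∫⁻ t in Ioi (0 : ℝ), ν {x | ENNReal.ofReal t < F x} * ENNReal.ofReal (t ^ (δ - 1)) ≤
      (∫⁻ t in Ioi (0 : ℝ), ν {x | ENNReal.ofReal t < H x} * ENNReal.ofReal (t ^ (δ - 1))) +
      C * ∫⁻ t in Ioi (0 : ℝ), μ {x | ENNReal.ofReal t < G x} *
        ENNReal.ofReal (t ^ (1 + δ - 1)) := by
    rw [← lintegral_const_mul C ((hmono μ G).fun_mul (hrpow (1 + δ - 1))),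
      ← lintegral_add_left ((hmono ν H).fun_mul (hrpow (δ - 1)))]
    refine setLIntegral_mono' measurableSet_Ioi fun t (ht : 0 < t) => ?_
    have e : t ^ (1 + δ - 1) = t * t ^ (δ - 1) := by
      rw [← Real.rpow_one_add' ht.le (by linarith)]
      congr 1; ring
    rw [e, ENNReal.ofReal_mul ht.le]
    refine (mul_le_mul' (h t ht) le_rfl).trans_eq ?_
    ring
  refine (mul_le_mul' le_rfl h1).trans ?_
  rw [mul_add]
  have h2 : (1 : ℝ≥0∞) ≤ ENNReal.ofReal (1 + δ) := by
    rw [ENNReal.one_le_ofReal]; linarith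
  refine add_le_add le_rfl ?_
  generalize ∫⁻ t in Ioi (0 : ℝ), μ {x | ENNReal.ofReal t < G x} *
    ENNReal.ofReal (t ^ (1 + δ - 1)) = I
  calc _ = C * ENNReal.ofReal δ * (1 * I) := by ring
    _ ≤ _ := mul_le_mul' le_rfl (mul_le_mul' h2 le_rfl)

/-- The reverse Hölder condition, without quotients. -/
def RevHolder (τ : ℝ) (w : Rn n → ℝ≥0∞) : Prop :=
  ∃ K : ℝ≥0, ∀ (a : Rn n) (ρ : ℝ), 0 < ρ →
    wMeas (fun x => w x ^ τ) (cube a ρ) * volume (cube a ρ) ^ (τ - 1) ≤ K * wMeas w (cube a ρ) ^ τ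

theorem RevHolder.congr {τ : ℝ} {w w' : Rn n → ℝ≥0∞} (hw : RevHolder τ w)
    (h : w =ᵐ[volume] w') : RevHolder τ w' := by
  obtain ⟨K, hK⟩ := hw
  refine ⟨K, fun a ρ hρ => ?_⟩
  have h' : (fun x => w x ^ τ) =ᵐ[volume] fun x => w' x ^ τ := by
    filter_upwards [h] with x h1
    rw [h1]
  rw [← wMeas_congr h, ← wMeas_congr h']
  exact hK a ρ hρ

/-- Gehring's argument: the level-set estimate bounds the integral of `w^{1+δ}` by the wanted term
plus a small multiple of itself. Truncation at `N` makes that integral finite, so that it can be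
absorbed; the bound does not depend on `N`. -/
theorem setLIntegral_min_rpow_le {w : Rn n → ℝ≥0∞} (hwm : Measurable w) {θ : ℝ} (hθ0 : 0 < θ)
    (hθ1 : θ ≤ 1)
    (hθ : ∀ (a : Rn n) (ρ : ℝ), 0 < ρ → ∀ l : ℝ, 0 < l →
      ENNReal.ofReal l * volume (cube a ρ) ≤ wMeas w (cube a ρ) →
      volume (cube a ρ) ≤ 2 * volume (cube a ρ ∩ {x | ENNReal.ofReal (θ * l) < w x}))
    {δ : ℝ} (hδ : 0 < δ) (hδ1 : δ ≤ 1) (hδ2 : δ * 2 ^ (n + 2) ≤ θ ^ 2)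
    (a : Rn n) {ρ : ℝ} (hρ : 0 < ρ) (N : ℕ) :
    ∫⁻ x in cube a ρ, min (w x) N ^ (1 + δ) ≤
      2 * ((wMeas w (cube a ρ) / volume (cube a ρ)) ^ δ * wMeas w (cube a ρ)) := by
  set Q := cube a ρ with hQ
  have hQm : MeasurableSet Q := measurableSet_cube a ρ
  have hV0 : volume Q ≠ 0 := (volume_cube_pos a hρ).ne'
  have hVt : volume Q ≠ ∞ := (volume_cube_lt_top a ρ).ne
  set m := wMeas w Q / volume Q with hm
  set ν := (volume.withDensity w).restrict Q with hν
  set f : Rn n → ℝ≥0∞ := fun x => min (w x) N with hf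
  have hfm : Measurable f := hwm.min measurable_const
  have hθinv : ENNReal.ofReal θ * ENNReal.ofReal θ⁻¹ = 1 := by
    rw [← ENNReal.ofReal_mul hθ0.le, mul_inv_cancel₀ hθ0.ne', ENNReal.ofReal_one]
  -- Below the mean `m` the constant function `m` accounts for the whole level set. Above `N` the
  -- level set is empty. In between, truncation does not affect the levels `t` and `θt`, and the
  -- Calderón-Zygmund estimate applies.
  have hlevel : ∀ t : ℝ, 0 < t → ν {x | ENNReal.ofReal t < f x} ≤
      ν {x | ENNReal.ofReal t < m} + 2 ^ (n + 1) * ENNReal.ofReal t *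
        (volume.restrict Q) {x | ENNReal.ofReal t < ENNReal.ofReal θ⁻¹ * f x} := by
    intro t ht
    by_cases htm : ENNReal.ofReal t < m
    · refine le_trans ?_ (le_self_add)
      exact measure_mono fun _ _ => htm
    refine le_trans ?_ (le_add_self)
    by_cases htN : (N : ℝ≥0∞) ≤ ENNReal.ofReal t
    · have : {x | ENNReal.ofReal t < f x} = ∅ := by
        refine eq_empty_of_forall_notMem fun x hx => ?_
        exact absurd (hx.trans_le (min_le_right _ _)) (not_lt.2 htN)
      rw [this, measure_empty]
      exact zero_le
    push Not at htm htN
    have hroot : wMeas w Q ≤ ENNReal.ofReal t * volume Q := by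
      rwa [hm, ENNReal.div_le_iff hV0 hVt] at htm
    have h1 := setLIntegral_superlevel_le hwm hθ a hρ ht hroot
    rw [← hQ] at h1
    have e1 : ν {x | ENNReal.ofReal t < f x} ≤
        volume.withDensity w (Q ∩ {x | ENNReal.ofReal t < w x}) := by
      rw [hν, Measure.restrict_apply (measurableSet_lt measurable_const hfm), inter_comm]
      refine measure_mono (inter_subset_inter_right _ fun x hx => ?_)
      exact lt_of_lt_of_le (mem_ofPred_eq ▸ hx) (min_le_left _ _)
    refine e1.trans (h1.trans ?_)
    rw [Measure.restrict_apply (measurableSet_lt measurable_const (hfm.const_mul _)),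
      inter_comm Q]
    refine mul_le_mul' le_rfl (measure_mono (inter_subset_inter_left _ fun x hx => ?_))
    simp only [mem_ofPred_eq] at hx ⊢
    have h2 : ENNReal.ofReal (θ * t) < f x := by
      refine lt_min hx (lt_of_le_of_lt (ENNReal.ofReal_le_ofReal ?_) htN)
      nlinarith
    have hθi0 : ENNReal.ofReal θ⁻¹ ≠ 0 := by simpa using hθ0
    have h3 := ENNReal.mul_lt_mul_right hθi0 ENNReal.ofReal_ne_top h2
    rwa [ENNReal.ofReal_mul hθ0.le, ← mul_assoc, mul_comm (ENNReal.ofReal θ⁻¹), hθinv,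
      one_mul] at h3
  have key := lintegral_rpow_le_of_meas_lt_le_add (μ := volume.restrict Q) (ν := ν)
    hfm.aemeasurable aemeasurable_const (hfm.const_mul _).aemeasurable hδ _ hlevel
  have eF : ∫⁻ x, f x ^ δ ∂ν = ∫⁻ x in Q, w x * f x ^ δ := by
    rw [hν, setLIntegral_withDensity_eq_setLIntegral_mul _ hwm (hfm.pow_const _) hQm]
    rfl
  have eH : ∫⁻ _, m ^ δ ∂ν = m ^ δ * wMeas w Q := by
    rw [lintegral_const, hν, Measure.restrict_apply_univ, withDensity_apply _ hQm]
    rfl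
  set I := ∫⁻ x in Q, f x ^ (1 + δ) with hI
  have eG : ∫⁻ x in Q, (ENNReal.ofReal θ⁻¹ * f x) ^ (1 + δ) =
      ENNReal.ofReal θ⁻¹ ^ (1 + δ) * I := by
    rw [hI, ← lintegral_const_mul _ (hfm.pow_const _)]
    refine lintegral_congr fun x => ?_
    rw [ENNReal.mul_rpow_of_nonneg _ _ (by linarith)]
  rw [eF, eH, eG] at key
  have hIle : I ≤ ∫⁻ x in Q, w x * f x ^ δ := by
    refine lintegral_mono fun x => ?_
    simp only
    rw [ENNReal.rpow_add_of_nonneg _ _ zero_le_one hδ.le, ENNReal.rpow_one]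
    gcongr
    exact min_le_left _ _
  have hIt : I ≠ ∞ := by
    have : I ≤ ∫⁻ _ in Q, (N : ℝ≥0∞) ^ (1 + δ) := by
      refine lintegral_mono fun x => ?_
      simp only
      gcongr
      exact min_le_right _ _
    refine ne_top_of_le_ne_top ?_ this
    rw [setLIntegral_const]
    exact ENNReal.mul_ne_top (ENNReal.rpow_ne_top_of_nonneg (by linarith) (by simp)) hVt
  -- The smallness condition on `δ` is made for this: `θ^{-(1+δ)} ≤ θ^{-2}`, so the absorbed term
  -- has coefficient at most one half.
  have hcoef : 2 ^ (n + 1) * ENNReal.ofReal δ * ENNReal.ofReal θ⁻¹ ^ (1 + δ) ≤ 2⁻¹ := by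
    have hθi1 : 1 ≤ θ⁻¹ := (one_le_inv₀ hθ0).2 hθ1
    rw [ENNReal.ofReal_rpow_of_pos (by positivity),
      show (2 : ℝ≥0∞) ^ (n + 1) = ENNReal.ofReal (2 ^ (n + 1)) by
        rw [ENNReal.ofReal_pow (by norm_num)]; simp,
      ← ENNReal.ofReal_mul (by positivity), ← ENNReal.ofReal_mul (by positivity),
      show (2 : ℝ≥0∞)⁻¹ = ENNReal.ofReal (2⁻¹) by
        rw [ENNReal.ofReal_inv_of_pos (by norm_num)]; simp]
    refine ENNReal.ofReal_le_ofReal ?_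
    have h1 : θ⁻¹ ^ (1 + δ) ≤ θ⁻¹ ^ (2 : ℝ) :=
      Real.rpow_le_rpow_of_exponent_le hθi1 (by linarith)
    rw [Real.rpow_two] at h1
    calc (2 : ℝ) ^ (n + 1) * δ * θ⁻¹ ^ (1 + δ) ≤ 2 ^ (n + 1) * δ * θ⁻¹ ^ 2 := by gcongr
      _ = (δ * 2 ^ (n + 2)) * (2⁻¹ * θ⁻¹ ^ 2) := by ring
      _ ≤ θ ^ 2 * (2⁻¹ * θ⁻¹ ^ 2) := by gcongr
      _ = 2⁻¹ := by field_simp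
  have h3 : I ≤ m ^ δ * wMeas w Q + 2⁻¹ * I := by
    refine hIle.trans (key.trans ?_)
    rw [← mul_assoc]
    gcongr
  have h4 : I + I ≤ 2 * (m ^ δ * wMeas w Q) + I := by
    calc I + I = 2 * I := by ring
      _ ≤ 2 * (m ^ δ * wMeas w Q + 2⁻¹ * I) := by gcongr
      _ = 2 * (m ^ δ * wMeas w Q) + (2 * 2⁻¹) * I := by ring
      _ = _ := by rw [ENNReal.mul_inv_cancel (by simp) (by simp), one_mul]
  exact (ENNReal.add_le_add_iff_right hIt).1 h4

/-- Muckenhoupt weights satisfy a reverse Hölder inequality. -/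
theorem IsMuckenhoupt.revHolder {t : ℝ} (ht : 1 < t) {w : Rn n → ℝ≥0∞}
    (hw : IsMuckenhoupt t w) : ∃ δ₀ : ℝ, 0 < δ₀ ∧ ∀ δ, 0 < δ → δ ≤ δ₀ → RevHolder (1 + δ) w := by
  have hae := hw.aemeasurable.ae_eq_mk
  have hwm := hw.aemeasurable.measurable_mk
  set w' := hw.aemeasurable.mk w with hw'
  have hM := hw.congr hae
  obtain ⟨θ, hθ0, hθ1, hθ⟩ := hM.exists_volume_le ht hwm
  refine ⟨min 1 (θ ^ 2 / 2 ^ (n + 2)), by positivity, fun δ hδ hδ0 => ?_⟩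
  have hδ1 := hδ0.trans (min_le_left _ _)
  have hδ2 := hδ0.trans (min_le_right _ _)
  rw [le_div_iff₀ (by positivity)] at hδ2
  refine RevHolder.congr ?_ hae.symm
  refine ⟨2, fun a ρ hρ => ?_⟩
  have hV0 : volume (cube a ρ) ≠ 0 := (volume_cube_pos a hρ).ne'
  have hVt : volume (cube a ρ) ≠ ∞ := (volume_cube_lt_top a ρ).ne
  have hlim : Filter.Tendsto (fun N : ℕ => ∫⁻ x in cube a ρ, min (w' x) N ^ (1 + δ)) Filter.atTop
      (nhds (wMeas (fun x => w' x ^ (1 + δ)) (cube a ρ))) := by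
    refine lintegral_tendsto_of_tendsto_of_monotone ?_ ?_ ?_
    · exact fun N => ((hwm.min measurable_const).pow_const _).aemeasurable
    · refine Filter.Eventually.of_forall fun x N M hNM => ?_
      simp only
      gcongr
    · filter_upwards [ae_restrict_of_ae hM.lt_top] with x hx
      obtain ⟨N, hN⟩ := ENNReal.exists_nat_gt hx.ne
      refine tendsto_const_nhds.congr' ?_
      filter_upwards [Filter.eventually_ge_atTop N] with M hNM
      rw [min_eq_left (hN.le.trans (by exact_mod_cast hNM))]
  have hle := le_of_tendsto' hlim fun N =>
    setLIntegral_min_rpow_le hwm hθ0 hθ1 hθ hδ hδ1 hδ2 a hρ N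
  rw [add_sub_cancel_left]
  calc _ ≤ 2 * ((wMeas w' (cube a ρ) / volume (cube a ρ)) ^ δ * wMeas w' (cube a ρ)) *
        volume (cube a ρ) ^ δ := by gcongr
    _ = 2 * (wMeas w' (cube a ρ) * (wMeas w' (cube a ρ) / volume (cube a ρ) *
          volume (cube a ρ)) ^ δ) := by
        rw [ENNReal.mul_rpow_of_nonneg _ _ hδ.le]; ring
    _ = _ := by
        rw [ENNReal.div_mul_cancel hV0 hVt, ENNReal.rpow_add_of_nonneg _ _ zero_le_one hδ.le,
          ENNReal.rpow_one]
        rfl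

end ReverseHolder

/-! ### Duality and self-improvement of weight classes -/

section Openness

variable {n : ℕ}

theorem wMeas_cube_lt_top_of_pos {w : Rn n → ℝ≥0∞}
    (h : ∀ a ρ, 0 < ρ → wMeas w (cube a ρ) < ∞) (a : Rn n) (ρ : ℝ) : wMeas w (cube a ρ) < ∞ :=
  (wMeas_mono w (cube_mono a ((le_abs_self ρ).trans (by linarith)))).trans_lt
    (h a (|ρ| + 1) (by positivity))

theorem ae_pos_rpow {w : Rn n → ℝ≥0∞} (h0 : ∀ᵐ x, 0 < w x) (ht : ∀ᵐ x, w x < ∞) (s : ℝ) :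
    ∀ᵐ x, 0 < w x ^ s := by
  filter_upwards [h0, ht] with x h1 h2 using ENNReal.rpow_pos h1 h2.ne

theorem ae_rpow_lt_top {w : Rn n → ℝ≥0∞} (h0 : ∀ᵐ x, 0 < w x) (ht : ∀ᵐ x, w x < ∞) (s : ℝ) :
    ∀ᵐ x, w x ^ s < ∞ := by
  filter_upwards [h0, ht] with x h1 h2
    using lt_top_iff_ne_top.2 (ENNReal.rpow_ne_top_of_ne_zero h1.ne' h2.ne)

/-- The dual condition is the original one raised to the power `1/(t-1)`. The dual weight is finite
on cubes because `w(Q) > 0` and the product is bounded. -/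
theorem IsMuckenhoupt.dual {t : ℝ} (ht : 1 < t) {w : Rn n → ℝ≥0∞} (hw : IsMuckenhoupt t w) :
    IsMuckenhoupt (t / (t - 1)) (fun x => w x ^ (-(t - 1)⁻¹)) := by
  have ht1 : 0 < t - 1 := by linarith
  have e1 : t / (t - 1) - 1 = (t - 1)⁻¹ := by field_simp; ring
  obtain ⟨C, hC⟩ := hw.bound
  refine ⟨hw.aemeasurable.pow_const _, ae_pos_rpow hw.pos hw.lt_top _,
    ae_rpow_lt_top hw.pos hw.lt_top _, wMeas_cube_lt_top_of_pos fun a ρ hρ => ?_,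
    C ^ (t - 1)⁻¹, fun a ρ hρ => ?_⟩
  · have h1 := hC a ρ hρ
    have h2 : (C : ℝ≥0∞) * volume (cube a ρ) ^ t < ∞ := ENNReal.mul_lt_top ENNReal.coe_lt_top
      (ENNReal.rpow_lt_top_of_nonneg (by linarith) (volume_cube_lt_top a ρ).ne)
    rcases ENNReal.mul_lt_top_iff.1 (h1.trans_lt h2) with h | h | h
    · exact (ENNReal.rpow_lt_top_iff_of_pos ht1).1 h.2
    · exact absurd h (hw.wMeas_pos a hρ).ne'
    · rw [ENNReal.rpow_eq_zero_iff_of_pos ht1] at h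
      rw [h]
      exact ENNReal.zero_lt_top
  · rw [e1, inv_inv]
    have e2 : wMeas (fun x => (w x ^ (-(t - 1)⁻¹)) ^ (-(t - 1))) (cube a ρ) =
        wMeas w (cube a ρ) := by
      refine lintegral_congr fun x => ?_
      rw [← ENNReal.rpow_mul, neg_mul_neg, inv_mul_cancel₀ ht1.ne', ENNReal.rpow_one]
    rw [e2]
    have h1 := ENNReal.rpow_le_rpow (hC a ρ hρ) (inv_nonneg.2 ht1.le)
    rw [ENNReal.mul_rpow_of_nonneg _ _ (inv_nonneg.2 ht1.le),
      ENNReal.mul_rpow_of_nonneg _ _ (inv_nonneg.2 ht1.le), ENNReal.rpow_rpow_inv ht1.ne',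
      ← ENNReal.rpow_mul, ← div_eq_mul_inv,
      ← ENNReal.coe_rpow_of_nonneg _ (inv_nonneg.2 ht1.le)] at h1
    rw [mul_comm]
    exact h1

/-- The self-improving property of the Muckenhoupt classes. -/
theorem IsMuckenhoupt.exists_lt {t : ℝ} (ht : 1 < t) {w : Rn n → ℝ≥0∞} (hw : IsMuckenhoupt t w) :
    ∃ t₀ : ℝ, 1 < t₀ ∧ t₀ < t ∧ ∀ t₁, t₀ ≤ t₁ → t₁ ≤ t → IsMuckenhoupt t₁ w := by
  have ht1 : 0 < t - 1 := by linarith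
  obtain ⟨δ₀, hδ₀, hRH⟩ := (hw.dual ht).revHolder ((one_lt_div ht1).2 (by linarith))
  have hpos : 0 < (t - 1) / (1 + δ₀) := by positivity
  -- A reverse Hölder inequality with exponent `1 + δ` for `w^{-1/(t-1)}` concerns `w^{-1/(t₁-1)}`
  -- when `(t₁-1)(1+δ) = t-1`. The condition `δ ≤ δ₀` becomes a lower bound on `t₁`.
  refine ⟨1 + (t - 1) / (1 + δ₀), by linarith, ?_, fun t₁ h0 h1 => ?_⟩
  · have : (t - 1) / (1 + δ₀) < t - 1 := div_lt_self ht1 (by linarith)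
    linarith
  rcases h1.eq_or_lt with rfl | hlt
  · exact hw
  have ht₁ : 0 < t₁ - 1 := by linarith
  obtain ⟨δ, hδ⟩ : ∃ δ, (t₁ - 1) * (1 + δ) = t - 1 :=
    ⟨(t - 1) / (t₁ - 1) - 1, by field_simp; ring⟩
  have hδpos : 0 < δ := by
    by_contra! hneg
    nlinarith
  have hδle : δ ≤ δ₀ := by
    have h2 : (t - 1) / (1 + δ₀) ≤ t₁ - 1 := by linarith
    rw [div_le_iff₀ (by positivity), ← hδ] at h2
    have h3 := le_of_mul_le_mul_left h2 ht₁
    linarith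
  obtain ⟨K, hK⟩ := hRH δ hδpos hδle
  obtain ⟨C, hC⟩ := hw.bound
  refine ⟨hw.aemeasurable, hw.pos, hw.lt_top, hw.wMeas_lt_top, K ^ (t₁ - 1) * C, fun a ρ hρ => ?_⟩
  have hV0 : volume (cube a ρ) ≠ 0 := (volume_cube_pos a hρ).ne'
  have hVt : volume (cube a ρ) ≠ ∞ := (volume_cube_lt_top a ρ).ne
  have e1 : wMeas (fun x => (w x ^ (-(t - 1)⁻¹)) ^ (1 + δ)) (cube a ρ) =
      wMeas (fun x => w x ^ (-(t₁ - 1)⁻¹)) (cube a ρ) := by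
    refine lintegral_congr fun x => ?_
    rw [← ENNReal.rpow_mul, ← hδ]
    congr 1
    field_simp
  have h2 := hK a ρ hρ
  have h3 := hC a ρ hρ
  rw [e1] at h2
  set V := volume (cube a ρ)
  set W := wMeas w (cube a ρ)
  set S := wMeas (fun x => w x ^ (-(t - 1)⁻¹)) (cube a ρ)
  set X := wMeas (fun x => w x ^ (-(t₁ - 1)⁻¹)) (cube a ρ)
  have h4 := ENNReal.rpow_le_rpow h2 ht₁.le
  rw [ENNReal.mul_rpow_of_nonneg _ _ ht₁.le, ENNReal.mul_rpow_of_nonneg _ _ ht₁.le,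
    ← ENNReal.rpow_mul, ← ENNReal.rpow_mul, mul_comm (1 + δ), hδ,
    show (1 + δ - 1) * (t₁ - 1) = t - t₁ by linarith] at h4
  have hU0 : V ^ (t - t₁) ≠ 0 := (ENNReal.rpow_pos (pos_iff_ne_zero.2 hV0) hVt).ne'
  have hUt : V ^ (t - t₁) ≠ ∞ := ENNReal.rpow_ne_top_of_ne_zero hV0 hVt
  rw [← ENNReal.mul_le_mul_iff_left hU0 hUt]
  calc W * X ^ (t₁ - 1) * V ^ (t - t₁) = W * (X ^ (t₁ - 1) * V ^ (t - t₁)) := mul_assoc _ _ _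
    _ ≤ W * ((K : ℝ≥0∞) ^ (t₁ - 1) * S ^ (t - 1)) := mul_le_mul' le_rfl h4
    _ = (K : ℝ≥0∞) ^ (t₁ - 1) * (W * S ^ (t - 1)) := by ring
    _ ≤ (K : ℝ≥0∞) ^ (t₁ - 1) * (C * V ^ t) := mul_le_mul' le_rfl h3
    _ = (K : ℝ≥0∞) ^ (t₁ - 1) * C * (V ^ t₁ * V ^ (t - t₁)) := by
        rw [← ENNReal.rpow_add _ _ hV0 hVt, mul_assoc]; congr 3; ring
    _ = _ := by
        rw [ENNReal.coe_mul, ENNReal.coe_rpow_of_nonneg _ ht₁.le]; ring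

/-- The self-improving property of the reverse Hölder classes. -/
theorem IsMuckenhoupt.exists_revHolder_gt {t : ℝ} (ht : 1 < t) {w : Rn n → ℝ≥0∞}
    (hw : IsMuckenhoupt t w) {τ : ℝ} (hτ : 1 < τ) (hR : RevHolder τ w) :
    ∃ τ₁, τ < τ₁ ∧ RevHolder τ₁ w := by
  have hτ0 : 0 < τ := by linarith
  have ht1 : 0 < t - 1 := by linarith
  obtain ⟨K, hK⟩ := hR
  obtain ⟨C, hC⟩ := hw.bound
  -- The exponent is such that the dual weight of `w^τ` is again `w^{-1/(t-1)}`. The power `w^τ`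
  -- thus has its own reverse Hölder inequality with some exponent `1 + δ`, and composing the two
  -- gives exponent `τ(1+δ)` for `w`.
  have hM : IsMuckenhoupt (1 + τ * (t - 1)) (fun x => w x ^ τ) := by
    refine ⟨hw.aemeasurable.pow_const _, ae_pos_rpow hw.pos hw.lt_top _,
      ae_rpow_lt_top hw.pos hw.lt_top _, wMeas_cube_lt_top_of_pos fun a ρ hρ => ?_,
      K * C ^ τ, fun a ρ hρ => ?_⟩
    · have h1 := (hK a ρ hρ).trans_lt (ENNReal.mul_lt_top ENNReal.coe_lt_top
        (ENNReal.rpow_lt_top_of_nonneg hτ0.le (hw.wMeas_lt_top a ρ).ne))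
      rcases ENNReal.mul_lt_top_iff.1 h1 with h | h | h
      · exact h.1
      · rw [h]
        exact ENNReal.zero_lt_top
      · exact absurd h (ENNReal.rpow_pos (volume_cube_pos a hρ) (volume_cube_lt_top a ρ).ne).ne'
    · have hV0 : volume (cube a ρ) ≠ 0 := (volume_cube_pos a hρ).ne'
      have hVt : volume (cube a ρ) ≠ ∞ := (volume_cube_lt_top a ρ).ne
      have h1 := hK a ρ hρ
      have h2 := ENNReal.rpow_le_rpow (hC a ρ hρ) hτ0.le
      have e1 : wMeas (fun x => (w x ^ τ) ^ (-(1 + τ * (t - 1) - 1)⁻¹)) (cube a ρ) =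
          wMeas (fun x => w x ^ (-(t - 1)⁻¹)) (cube a ρ) := by
        refine lintegral_congr fun x => ?_
        rw [← ENNReal.rpow_mul]
        congr 1
        rw [add_sub_cancel_left]
        field_simp
      rw [e1, add_sub_cancel_left]
      set V := volume (cube a ρ)
      set W := wMeas w (cube a ρ)
      set S := wMeas (fun x => w x ^ (-(t - 1)⁻¹)) (cube a ρ)
      set A := wMeas (fun x => w x ^ τ) (cube a ρ)
      rw [ENNReal.mul_rpow_of_nonneg _ _ hτ0.le, ENNReal.mul_rpow_of_nonneg _ _ hτ0.le,
        ← ENNReal.rpow_mul, ← ENNReal.rpow_mul] at h2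
      have hU0 : V ^ (τ - 1) ≠ 0 := (ENNReal.rpow_pos (pos_iff_ne_zero.2 hV0) hVt).ne'
      have hUt : V ^ (τ - 1) ≠ ∞ := ENNReal.rpow_ne_top_of_ne_zero hV0 hVt
      rw [← ENNReal.mul_le_mul_iff_left hU0 hUt]
      calc A * S ^ (τ * (t - 1)) * V ^ (τ - 1) = A * V ^ (τ - 1) * S ^ ((t - 1) * τ) := by
            rw [mul_comm τ]; ring
        _ ≤ K * W ^ τ * S ^ ((t - 1) * τ) := mul_le_mul' h1 le_rfl
        _ = K * (W ^ τ * S ^ ((t - 1) * τ)) := mul_assoc _ _ _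
        _ ≤ K * ((C : ℝ≥0∞) ^ τ * V ^ (t * τ)) := mul_le_mul' le_rfl h2
        _ = K * (C : ℝ≥0∞) ^ τ * (V ^ (1 + τ * (t - 1)) * V ^ (τ - 1)) := by
            rw [← ENNReal.rpow_add _ _ hV0 hVt, mul_assoc]; congr 3; ring
        _ = _ := by
            rw [ENNReal.coe_mul, ENNReal.coe_rpow_of_nonneg _ hτ0.le]; ring
  have hT : 1 < 1 + τ * (t - 1) := by
    have : 0 < τ * (t - 1) := by positivity
    linarith
  obtain ⟨δ, hδ, hRH⟩ := hM.revHolder hT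
  obtain ⟨K₂, hK₂⟩ := hRH δ hδ le_rfl
  have hδ1 : 0 ≤ 1 + δ := by linarith
  refine ⟨τ * (1 + δ), by nlinarith, K₂ * K ^ (1 + δ), fun a ρ hρ => ?_⟩
  have hV0 : volume (cube a ρ) ≠ 0 := (volume_cube_pos a hρ).ne'
  have hVt : volume (cube a ρ) ≠ ∞ := (volume_cube_lt_top a ρ).ne
  have h1 := ENNReal.rpow_le_rpow (hK a ρ hρ) hδ1
  have h2 := hK₂ a ρ hρ
  have e1 : wMeas (fun x => (w x ^ τ) ^ (1 + δ)) (cube a ρ) =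
      wMeas (fun x => w x ^ (τ * (1 + δ))) (cube a ρ) := by
    refine lintegral_congr fun x => ?_
    rw [← ENNReal.rpow_mul]
  rw [e1, add_sub_cancel_left] at h2
  set V := volume (cube a ρ)
  set W := wMeas w (cube a ρ)
  set A := wMeas (fun x => w x ^ τ) (cube a ρ)
  set B := wMeas (fun x => w x ^ (τ * (1 + δ))) (cube a ρ)
  rw [ENNReal.mul_rpow_of_nonneg _ _ hδ1, ENNReal.mul_rpow_of_nonneg _ _ hδ1,
    ← ENNReal.rpow_mul, ← ENNReal.rpow_mul] at h1
  calc B * V ^ (τ * (1 + δ) - 1) = B * V ^ δ * V ^ ((τ - 1) * (1 + δ)) := by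
        rw [mul_assoc, ← ENNReal.rpow_add _ _ hV0 hVt]; congr 2; ring
    _ ≤ K₂ * A ^ (1 + δ) * V ^ ((τ - 1) * (1 + δ)) := mul_le_mul' h2 le_rfl
    _ = K₂ * (A ^ (1 + δ) * V ^ ((τ - 1) * (1 + δ))) := mul_assoc _ _ _
    _ ≤ K₂ * ((K : ℝ≥0∞) ^ (1 + δ) * W ^ (τ * (1 + δ))) := mul_le_mul' le_rfl h1
    _ = _ := by rw [ENNReal.coe_mul, ENNReal.coe_rpow_of_nonneg _ hδ1]; ring

/-- Hölder's inequality on the small cube, monotonicity of the integral of `w^τ`, and the reverse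
Hölder inequality on the large cube combine to `w(Q)/w(2^j Q) ≲ (|Q|/|2^j Q|)^{1-1/τ}`. -/
theorem RevHolder.exists_decay {w : Rn n → ℝ≥0∞} (hw : AEMeasurable w volume) {τ : ℝ}
    (hτ : 1 < τ) (hR : RevHolder τ w) : ∃ C : ℝ≥0, ∀ (a : Rn n) (ρ : ℝ), 0 < ρ → ∀ j : ℕ,
      wMeas w (cube a ρ) * 2 ^ (j * (n * (1 - 1 / τ))) ≤ C * wMeas w (cube a (2 ^ j * ρ)) := by
  have hτ0 : 0 < τ := by linarith
  obtain ⟨K, hK⟩ := hR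
  refine ⟨K ^ τ⁻¹, fun a ρ hρ j => ?_⟩
  have h1 := hK a (2 ^ j * ρ) (by positivity)
  have h2 := lintegral_rpow_le_weighted (μ := volume.restrict (cube a ρ)) (w := fun _ => 1)
    (by fun_prop) (by simp) (by simp) hτ hw.restrict
  simp only [mul_one, ENNReal.one_rpow, lintegral_const, Measure.restrict_apply_univ, one_mul] at h2
  have h3 : wMeas (fun x => w x ^ τ) (cube a ρ) ≤ wMeas (fun x => w x ^ τ) (cube a (2 ^ j * ρ)) :=
    wMeas_mono _ (cube_mono a (le_mul_of_one_le_left hρ.le (one_le_pow₀ one_le_two)))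
  have hVV := volume_cube_two_pow_mul a ρ j
  have hV0 : volume (cube a ρ) ≠ 0 := (volume_cube_pos a hρ).ne'
  have hVt : volume (cube a ρ) ≠ ∞ := (volume_cube_lt_top a ρ).ne
  rw [hVV, ENNReal.mul_rpow_of_nonneg _ _ (by linarith), ← ENNReal.rpow_mul] at h1
  change wMeas w (cube a ρ) ^ τ ≤ wMeas (fun x => w x ^ τ) (cube a ρ) * _ at h2
  set V := volume (cube a ρ)
  set W := wMeas w (cube a ρ)
  set W' := wMeas w (cube a (2 ^ j * ρ))
  have hU0 : V ^ (τ - 1) ≠ 0 := (ENNReal.rpow_pos (pos_iff_ne_zero.2 hV0) hVt).ne'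
  have hUt : V ^ (τ - 1) ≠ ∞ := ENNReal.rpow_ne_top_of_ne_zero hV0 hVt
  have h4 : W ^ τ * 2 ^ (j * n * (τ - 1)) ≤ K * W' ^ τ := by
    calc _ ≤ wMeas (fun x => w x ^ τ) (cube a (2 ^ j * ρ)) * V ^ (τ - 1) *
          2 ^ (j * n * (τ - 1)) :=
          mul_le_mul' (h2.trans (mul_le_mul' h3 le_rfl)) le_rfl
      _ = wMeas (fun x => w x ^ τ) (cube a (2 ^ j * ρ)) * (2 ^ (j * n * (τ - 1)) *
          V ^ (τ - 1)) := by ring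
      _ ≤ _ := h1
  have h5 := ENNReal.rpow_le_rpow h4 (inv_nonneg.2 hτ0.le)
  rw [ENNReal.mul_rpow_of_nonneg _ _ (inv_nonneg.2 hτ0.le),
    ENNReal.mul_rpow_of_nonneg _ _ (inv_nonneg.2 hτ0.le), ENNReal.rpow_rpow_inv hτ0.ne',
    ENNReal.rpow_rpow_inv hτ0.ne', ← ENNReal.rpow_mul,
    ← ENNReal.coe_rpow_of_nonneg _ (inv_nonneg.2 hτ0.le)] at h5
  convert h5 using 3
  field_simp

theorem IsWeight.wMeas_lt_top {w : Rn n → ℝ≥0∞} (hw : IsWeight w) (a : Rn n) (ρ : ℝ) :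
    wMeas w (cube a ρ) < ∞ := by
  have h := (LocallyIntegrable.integrableOn_isCompact hw (isCompact_cube a ρ)).2
  simpa [HasFiniteIntegral, wMeas] using h

theorem IsWeight.ae_lt_top {w : Rn n → ℝ≥0∞} (hw : IsWeight w) : ∀ᵐ x, w x < ∞ := by
  have hm : AEMeasurable w volume := (LocallyIntegrable.aestronglyMeasurable hw).aemeasurable
  have h : ∀ j : ℕ, ∀ᵐ x ∂volume.restrict (cube (0 : Rn n) (2 ^ j * 1)), w x < ∞ := fun j =>
    ae_lt_top' hm.restrict (hw.wMeas_lt_top 0 _).ne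
  rw [← ae_restrict_iUnion_iff] at h
  have hU : ⋃ j : ℕ, cube (0 : Rn n) (2 ^ j * 1) = univ :=
    eq_univ_of_forall fun x => mem_iUnion.2 (iUnion_cube_two_pow 0 one_pos x)
  rwa [hU, Measure.restrict_univ] at h

theorem IsAp.isMuckenhoupt {t : ℝ} (ht : 1 < t) {w : Rn n → ℝ≥0∞} (hw : IsAp t w) :
    IsMuckenhoupt t w := by
  have ht1 : 0 < t - 1 := by linarith
  refine ⟨(LocallyIntegrable.aestronglyMeasurable hw.isWeight).aemeasurable, hw.pos,
    hw.isWeight.ae_lt_top, hw.isWeight.wMeas_lt_top, (ApConst t w).toNNReal, fun a ρ hρ => ?_⟩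
  have hV0 : volume (cube a ρ) ≠ 0 := (volume_cube_pos a hρ).ne'
  have hVt : volume (cube a ρ) ≠ ∞ := (volume_cube_lt_top a ρ).ne
  rw [ENNReal.coe_toNNReal hw.const_lt_top.ne]
  have h1 : cubeAvg w a ρ * cubeAvg (fun x => w x ^ (1 - Real.conjExponent t)) a ρ ^ (t - 1) ≤
      ApConst t w := le_iSup₂_of_le a ρ (le_iSup_of_le hρ le_rfl)
  have e1 : 1 - Real.conjExponent t = -(t - 1)⁻¹ := by
    rw [Real.conjExponent]; field_simp; ring
  rw [e1, cubeAvg, cubeAvg] at h1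
  set V := volume (cube a ρ)
  calc _ = (wMeas w (cube a ρ) / V * V) *
        (wMeas (fun x => w x ^ (-(t - 1)⁻¹)) (cube a ρ) / V * V) ^ (t - 1) := by
        rw [ENNReal.div_mul_cancel hV0 hVt, ENNReal.div_mul_cancel hV0 hVt]
    _ = (wMeas w (cube a ρ) / V * (wMeas (fun x => w x ^ (-(t - 1)⁻¹)) (cube a ρ) / V) ^ (t - 1)) *
        (V * V ^ (t - 1)) := by
        rw [ENNReal.mul_rpow_of_nonneg _ _ ht1.le]; ring
    _ ≤ ApConst t w * (V * V ^ (t - 1)) := mul_le_mul' h1 le_rfl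
    _ = _ := by
        nth_rewrite 1 [← ENNReal.rpow_one V]
        rw [← ENNReal.rpow_add _ _ hV0 hVt, add_sub_cancel]

theorem IsRH.revHolder {τ : ℝ} (hτ : 1 < τ) {w : Rn n → ℝ≥0∞} (hw : IsRH τ w) :
    RevHolder τ w := by
  have hτ0 : 0 < τ := by linarith
  obtain ⟨K, hK⟩ := hw.reverse_holder
  refine ⟨K ^ τ, fun a ρ hρ => ?_⟩
  have hV0 : volume (cube a ρ) ≠ 0 := (volume_cube_pos a hρ).ne'
  have hVt : volume (cube a ρ) ≠ ∞ := (volume_cube_lt_top a ρ).ne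
  have h1 := ENNReal.rpow_le_rpow (hK a ρ hρ) hτ0.le
  rw [one_div, ENNReal.rpow_inv_rpow hτ0.ne', ENNReal.mul_rpow_of_nonneg _ _ hτ0.le, cubeAvg,
    cubeAvg] at h1
  set V := volume (cube a ρ)
  calc _ = wMeas (fun x => w x ^ τ) (cube a ρ) / V * V ^ τ := by
        rw [ENNReal.rpow_sub _ _ hV0 hVt, ENNReal.rpow_one]
        simp only [div_eq_mul_inv]; ring
    _ ≤ (K : ℝ≥0∞) ^ τ * (wMeas w (cube a ρ) / V) ^ τ * V ^ τ := mul_le_mul' h1 le_rfl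
    _ = (K : ℝ≥0∞) ^ τ * (wMeas w (cube a ρ) / V * V) ^ τ := by
        rw [ENNReal.mul_rpow_of_nonneg _ _ hτ0.le]; ring
    _ = _ := by rw [ENNReal.div_mul_cancel hV0 hVt, ENNReal.coe_rpow_of_nonneg _ hτ0.le]

end Openness

/-! ### Maximal functions and Muckenhoupt's theorem -/

section Maximal

variable {n : ℕ}

/-- The uncentred maximal function over cubes with respect to a measure. -/
noncomputable def maximalFnOf (μ : Measure (Rn n)) (f : Rn n → ℝ≥0∞) (x : Rn n) : ℝ≥0∞ :=
  ⨆ (a : Rn n) (ρ : ℝ) (_ : 0 < ρ) (_ : x ∈ cube a ρ), (∫⁻ y in cube a ρ, f y ∂μ) / μ (cube a ρ)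

theorem lt_maximalFnOf_iff {μ : Measure (Rn n)} {f : Rn n → ℝ≥0∞} {x : Rn n} {l : ℝ≥0∞} :
    l < maximalFnOf μ f x ↔ ∃ (a : Rn n) (ρ : ℝ), 0 < ρ ∧ x ∈ cube a ρ ∧
      l < (∫⁻ y in cube a ρ, f y ∂μ) / μ (cube a ρ) := by
  simp only [maximalFnOf, lt_iSup_iff, exists_prop]

theorem tendsto_measure_cube {μ : Measure (Rn n)} (hμ : ∀ a ρ, μ (cube a ρ) < ∞) (a : Rn n)
    (ρ : ℝ) : Filter.Tendsto (fun k : ℕ => μ (cube a (ρ + 1 / ((k : ℝ) + 1)))) Filter.atTop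
      (nhds (μ (cube a ρ))) := by
  have hlim : Filter.Tendsto (fun k : ℕ => ρ + 1 / ((k : ℝ) + 1)) Filter.atTop (nhds (ρ + 0)) :=
    tendsto_const_nhds.add tendsto_one_div_add_atTop_nhds_zero_nat
  rw [add_zero] at hlim
  have hI : cube a ρ = ⋂ k : ℕ, cube a (ρ + 1 / ((k : ℝ) + 1)) := by
    refine Subset.antisymm (subset_iInter fun k => cube_mono a ?_) fun x hx i => ?_
    · have : (0 : ℝ) < 1 / ((k : ℝ) + 1) := by positivity
      linarith
    · exact ge_of_tendsto' hlim fun k => mem_iInter.1 hx k i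
  rw [hI]
  refine tendsto_measure_iInter_atTop (fun k => (measurableSet_cube _ _).nullMeasurableSet)
    (fun j k hjk => cube_mono a ?_) ⟨0, (hμ _ _).ne⟩
  have := one_div_le_one_div_of_le (by positivity : (0 : ℝ) < (j : ℝ) + 1)
    (by gcongr : (j : ℝ) + 1 ≤ (k : ℝ) + 1)
  linarith

/-- Superlevel sets are open: a slight enlargement of an admissible closed cube keeps the average
above the level, by continuity of the measure from above, and contains the point in its interior. -/
theorem measurable_maximalFnOf {μ : Measure (Rn n)} (hμ : ∀ a ρ, μ (cube a ρ) < ∞)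
    (f : Rn n → ℝ≥0∞) : Measurable (maximalFnOf μ f) := by
  refine measurable_of_Ioi fun l => IsOpen.measurableSet (isOpen_iff_mem_nhds.2 fun x hx => ?_)
  obtain ⟨a, ρ, hρ, hx, hl⟩ := lt_maximalFnOf_iff.1 hx
  have h1 := ENNReal.Tendsto.const_div (a := ∫⁻ y in cube a ρ, f y ∂μ)
    (tendsto_measure_cube hμ a ρ) (Or.inl (hμ a ρ).ne)
  obtain ⟨k, hk⟩ := (h1.eventually (lt_mem_nhds hl)).exists
  have hk0 : (0 : ℝ) < 1 / ((k : ℝ) + 1) := by positivity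
  refine Filter.mem_of_superset (mem_interior_iff_mem_nhds.1
    (cube_subset_interior a (lt_add_of_pos_right ρ hk0) hx)) fun y hy => ?_
  refine lt_maximalFnOf_iff.2 ⟨a, _, by positivity, hy, hk.trans_le ?_⟩
  gcongr
  exact cube_mono a (le_add_of_nonneg_right hk0.le)

theorem maximalFnOf_weak_type {μ : Measure (Rn n)} {D : ℝ≥0∞}
    (hD : ∀ a ρ, 0 < ρ → μ (cube a (5 * ρ)) ≤ D * μ (cube a ρ)) (f : Rn n → ℝ≥0∞) (l : ℝ≥0∞) :
    μ {x | l < maximalFnOf μ f x} * l ≤ D * ∫⁻ x, f x ∂μ := by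
  let U : ℕ → Set (Rn n) := fun R => {x | ∃ (a : Rn n) (ρ : ℝ), (0 < ρ ∧ ρ ≤ R) ∧ x ∈ cube a ρ ∧
      l < (∫⁻ y in cube a ρ, f y ∂μ) / μ (cube a ρ)}
  have hU : {x | l < maximalFnOf μ f x} = ⋃ R, U R := by
    ext x
    simp only [mem_ofPred_eq, mem_iUnion, lt_maximalFnOf_iff, U]
    constructor
    · rintro ⟨a, ρ, hρ, h⟩
      obtain ⟨R, hR⟩ := exists_nat_ge ρ
      exact ⟨R, a, ρ, ⟨hρ, hR⟩, h⟩
    · rintro ⟨R, a, ρ, hρ, h⟩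
      exact ⟨a, ρ, hρ.1, h⟩
  have hUmono : Monotone U := by
    rintro R R' hRR x ⟨a, ρ, hρ, h⟩
    exact ⟨a, ρ, ⟨hρ.1, hρ.2.trans (by exact_mod_cast hRR)⟩, h⟩
  rw [hU, hUmono.measure_iUnion, ENNReal.iSup_mul]
  refine iSup_le fun R => ?_
  let B : Rn n × ℝ → Set (Rn n) := fun q => cube q.1 q.2
  let T : Set (Rn n × ℝ) := {q | (0 < q.2 ∧ q.2 ≤ R) ∧
    l < (∫⁻ y in cube q.1 q.2, f y ∂μ) / μ (cube q.1 q.2)}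
  -- The covering lemma needs bounded radii, hence the exhaustion by `R`. A cube meeting a selected
  -- one and at most twice as large lies in its dilate by `1 + 2 * 2 = 5`.
  obtain ⟨u, hut, hdisj, hcov⟩ := Vitali.exists_disjoint_subfamily_covering_enlargement B T
    (fun q => q.2) 2 one_lt_two (fun q hq => hq.1.1.le) R (fun q hq => hq.1.2)
    (fun q hq => ⟨q.1, self_mem_cube _ hq.1.1.le⟩)
  have hcount : u.Countable := hdisj.countable_of_nonempty_interior
    fun q hq => interior_cube_nonempty _ (hut hq).1.1
  have hsub : U R ⊆ ⋃ q ∈ u, cube q.1 (5 * q.2) := by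
    rintro x ⟨b, r, hr, hx, hl⟩
    obtain ⟨q, hq, ⟨y, hy1, hy2⟩, hle⟩ := hcov (b, r) ⟨hr, hl⟩
    refine mem_iUnion₂.2 ⟨q, hq, fun i => ?_⟩
    dsimp only at hle
    have h1 := hx i
    have h2 := hy1 i
    have h3 := hy2 i
    dsimp only at h2 h3
    rw [abs_le] at h1 h2 h3 ⊢
    constructor <;> linarith
  calc μ (U R) * l ≤ (∑' q : u, μ (cube q.1.1 (5 * q.1.2))) * l := by
        gcongr
        exact (measure_mono hsub).trans (measure_biUnion_le μ hcount _)
    _ = ∑' q : u, μ (cube q.1.1 (5 * q.1.2)) * l := ENNReal.tsum_mul_right.symm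
    _ ≤ ∑' q : u, D * ∫⁻ y in B q, f y ∂μ := by
        refine ENNReal.tsum_le_tsum fun q => ?_
        have hq := hut q.2
        calc μ (cube q.1.1 (5 * q.1.2)) * l ≤ D * μ (cube q.1.1 q.1.2) * l := by
              gcongr
              exact hD _ _ hq.1.1
          _ = D * (l * μ (cube q.1.1 q.1.2)) := by ring
          _ ≤ _ := by
              gcongr
              exact ENNReal.mul_le_of_le_div hq.2.le
    _ = D * ∑' q : u, ∫⁻ y in B q, f y ∂μ := ENNReal.tsum_mul_left
    _ = D * ∫⁻ y in ⋃ q ∈ u, B q, f y ∂μ := by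
        rw [lintegral_biUnion hcount (fun q _ => measurableSet_cube _ _) hdisj]
    _ ≤ _ := by
        gcongr
        exact Measure.restrict_le_self

/-- Marcinkiewicz interpolation between the weak-type bound and the trivial bound for bounded
functions. At level `l` only the part of `f` above `l/2` matters, so the level sets are compared
with those of `2f` for the measure with density `f`. -/
theorem maximalFnOf_strong_type {μ : Measure (Rn n)} (hμ : ∀ a ρ, μ (cube a ρ) < ∞) {D : ℝ≥0∞}
    (hD : ∀ a ρ, 0 < ρ → μ (cube a (5 * ρ)) ≤ D * μ (cube a ρ)) {f : Rn n → ℝ≥0∞}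
    (hf : AEMeasurable f μ) {κ : ℝ} (hκ : 1 < κ) :
    ∫⁻ x, maximalFnOf μ f x ^ κ ∂μ ≤
      2 * D * ENNReal.ofReal (κ / (κ - 1)) * 2 ^ (κ - 1) * ∫⁻ x, f x ^ κ ∂μ := by
  have hfd : AEMeasurable f (μ.withDensity f) :=
    hf.mono_ac (withDensity_absolutelyContinuous _ _)
  have key := lintegral_rpow_le_of_meas_lt_le (μ := μ) (ν := μ.withDensity f)
    (F := maximalFnOf μ f) (G := fun x => 2 * f x)
    (measurable_maximalFnOf hμ f).aemeasurable (hfd.const_mul 2) hκ (2 * D) (fun t ht => by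
      set l := ENNReal.ofReal t with hl
      have hlt : l ≠ ∞ := ENNReal.ofReal_ne_top
      have hAm : NullMeasurableSet {x | l / 2 < f x} μ :=
        nullMeasurableSet_lt aemeasurable_const hf
      have hsub : {x | l < maximalFnOf μ f x} ⊆
          {x | l / 2 < maximalFnOf μ ({x | l / 2 < f x}.indicator f) x} := by
        intro x hx
        obtain ⟨a, ρ, hρ, hxQ, hlQ⟩ := lt_maximalFnOf_iff.1 hx
        refine lt_maximalFnOf_iff.2 ⟨a, ρ, hρ, hxQ, ?_⟩
        have h1 : ∫⁻ y in cube a ρ, f y ∂μ ≤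
            ∫⁻ y in cube a ρ, {x | l / 2 < f x}.indicator f y ∂μ + l / 2 * μ (cube a ρ) := by
          rw [← setLIntegral_const, ← lintegral_add_right _ measurable_const]
          refine lintegral_mono fun y => ?_
          by_cases hy : l / 2 < f y
          · rw [indicator_of_mem (by exact hy)]
            exact le_self_add
          · exact (not_lt.1 hy).trans le_add_self
        have h2 := hlQ.trans_le (ENNReal.div_le_div_right h1 _)
        rw [ENNReal.add_div] at h2
        have h3 : l / 2 * μ (cube a ρ) / μ (cube a ρ) ≤ l / 2 :=
          ENNReal.div_le_of_le_mul le_rfl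
        have h4 := h2.trans_le (add_le_add le_rfl h3)
        nth_rewrite 1 [← ENNReal.add_halves l] at h4
        exact lt_of_add_lt_add_right h4
      have h1 := maximalFnOf_weak_type hD ({x | l / 2 < f x}.indicator f) (l / 2)
      rw [lintegral_indicator₀ hAm] at h1
      have e1 : (μ.withDensity f) {x | l < 2 * f x} = ∫⁻ x in {x | l / 2 < f x}, f x ∂μ := by
        rw [← withDensity_apply₀ f hAm]
        congr 1
        ext x
        simp only [mem_ofPred_eq]
        rw [ENNReal.div_lt_iff (by simp) (by simp), mul_comm]
      rw [e1]
      calc μ {x | l < maximalFnOf μ f x} * l = μ {x | l < maximalFnOf μ f x} * (2 * (l / 2)) := by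
            rw [ENNReal.mul_div_cancel (by simp) (by simp)]
        _ ≤ μ {x | l / 2 < maximalFnOf μ ({x | l / 2 < f x}.indicator f) x} * (2 * (l / 2)) := by
            gcongr
        _ = 2 * (μ {x | l / 2 < maximalFnOf μ ({x | l / 2 < f x}.indicator f) x} * (l / 2)) := by
            ring
        _ ≤ 2 * (D * ∫⁻ x in {x | l / 2 < f x}, f x ∂μ) := by gcongr
        _ = _ := by ring)
  refine key.trans_eq ?_
  rw [lintegral_withDensity_eq_lintegral_mul₀ hf ((hf.const_mul 2).pow_const _)]
  have e2 : ∫⁻ x, (f * fun x => (2 * f x) ^ (κ - 1)) x ∂μ = 2 ^ (κ - 1) * ∫⁻ x, f x ^ κ ∂μ := by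
    rw [← lintegral_const_mul'' _ (hf.pow_const _)]
    refine lintegral_congr fun x => ?_
    simp only [Pi.mul_apply]
    rw [ENNReal.mul_rpow_of_nonneg _ _ (by linarith), mul_left_comm]
    congr 1
    nth_rewrite 1 [← ENNReal.rpow_one (f x)]
    rw [← ENNReal.rpow_add_of_nonneg _ _ zero_le_one (by linarith), add_sub_cancel]
  rw [e2]
  ring

/-- The averaging inequality on the large cube is tested with the indicator of the small one. -/
theorem IsMuckenhoupt.doubling {t : ℝ} (ht : 1 < t) {w : Rn n → ℝ≥0∞} (hw : IsMuckenhoupt t w)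
    {c : ℝ} (hc : 1 ≤ c) : ∃ D : ℝ≥0, ∀ (a : Rn n) (ρ : ℝ), 0 < ρ →
      wMeas w (cube a (c * ρ)) ≤ D * wMeas w (cube a ρ) := by
  obtain ⟨C, hC⟩ := hw.lintegral_rpow_mul_le ht
  have ht0 : 0 < t := by linarith
  refine ⟨C * (c.toNNReal ^ n) ^ t, fun a ρ hρ => ?_⟩
  have hsub : cube a ρ ⊆ cube a (c * ρ) := cube_mono a (le_mul_of_one_le_left hρ.le hc)
  have hm := measurableSet_cube a ρ
  have h1 := hC a (c * ρ) (by positivity) ((cube a ρ).indicator 1)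
    (measurable_one.indicator hm).aemeasurable
  have e1 : ∫⁻ x in cube a (c * ρ), (cube a ρ).indicator (1 : Rn n → ℝ≥0∞) x =
      volume (cube a ρ) := by
    rw [lintegral_indicator_one hm, Measure.restrict_apply hm, inter_eq_left.2 hsub]
  have e2 : ∫⁻ x in cube a (c * ρ), (cube a ρ).indicator (1 : Rn n → ℝ≥0∞) x ^ t * w x =
      wMeas w (cube a ρ) := by
    have : (fun x => (cube a ρ).indicator (1 : Rn n → ℝ≥0∞) x ^ t * w x) =
        (cube a ρ).indicator w := by
      ext x
      by_cases hx : x ∈ cube a ρ <;> simp [hx, ht0]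
    rw [this, lintegral_indicator hm, Measure.restrict_restrict hm, inter_eq_left.2 hsub, wMeas]
  rw [e1, e2, volume_cube_mul a a (by linarith), ENNReal.mul_rpow_of_nonneg _ _ ht0.le] at h1
  have hV0 : volume (cube a ρ) ≠ 0 := (volume_cube_pos a hρ).ne'
  have hVt : volume (cube a ρ) ≠ ∞ := (volume_cube_lt_top a ρ).ne
  have hU0 : volume (cube a ρ) ^ t ≠ 0 := (ENNReal.rpow_pos (pos_iff_ne_zero.2 hV0) hVt).ne'
  have hUt : volume (cube a ρ) ^ t ≠ ∞ := ENNReal.rpow_ne_top_of_ne_zero hV0 hVt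
  rw [← ENNReal.mul_le_mul_iff_right hU0 hUt]
  refine h1.trans_eq ?_
  rw [ENNReal.coe_mul, ENNReal.coe_rpow_of_nonneg _ ht0.le, ENNReal.coe_pow]
  simp only [ENNReal.ofReal]
  ring

/-- Muckenhoupt's theorem, for a weight in a smaller class. -/
theorem IsMuckenhoupt.lintegral_maximalFn_le {t v : ℝ} (ht : 1 < t) (hv : t < v)
    {w : Rn n → ℝ≥0∞} (hw : IsMuckenhoupt t w) : ∃ C : ℝ≥0, ∀ G : Rn n → ℝ≥0∞,
      AEMeasurable G volume → ∫⁻ x, maximalFn G x ^ v * w x ≤ C * ∫⁻ x, G x ^ v * w x := by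
  have ht0 : 0 < t := by linarith
  have hv0 : 0 < v := by linarith
  obtain ⟨C, hC⟩ := hw.lintegral_rpow_mul_le ht
  obtain ⟨D, hD⟩ := hw.doubling ht (c := 5) (by norm_num)
  set μ := volume.withDensity w with hμ
  have hμQ : ∀ a ρ, μ (cube a ρ) = wMeas w (cube a ρ) := fun a ρ =>
    withDensity_apply _ (measurableSet_cube a ρ)
  have hκ : 1 < v / t := (one_lt_div ht0).2 hv
  have hvt : 0 ≤ v / t := by positivity
  have hμint : ∀ F : Rn n → ℝ≥0∞, AEMeasurable F volume → ∫⁻ x, F x ∂μ = ∫⁻ x, F x * w x :=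
    fun F hF => by
      rw [hμ, lintegral_withDensity_eq_lintegral_mul₀ hw.aemeasurable hF]
      simp only [Pi.mul_apply, mul_comm]
  refine ⟨C ^ (v / t) * (2 * D * (v / t / (v / t - 1)).toNNReal * 2 ^ (v / t - 1)),
    fun G hG => ?_⟩
  have hGt : AEMeasurable (fun x => G x ^ t) volume := hG.pow_const _
  -- The Muckenhoupt condition dominates `MG` by the maximal function of `G^t` with respect to the
  -- doubling measure `w dx`; the latter is bounded on `L_{v/t}(w)` because `v/t > 1`.
  have hpt : ∀ x, maximalFn G x ≤ (C * maximalFnOf μ (fun y => G y ^ t) x) ^ t⁻¹ := by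
    intro x
    refine iSup_le fun a => iSup_le fun ρ => iSup_le fun hρ => iSup_le fun hx => ?_
    rw [ENNReal.le_rpow_inv_iff ht0]
    have hV0 : volume (cube a ρ) ≠ 0 := (volume_cube_pos a hρ).ne'
    have hVt : volume (cube a ρ) ≠ ∞ := (volume_cube_lt_top a ρ).ne
    have hU0 : volume (cube a ρ) ^ t ≠ 0 := (ENNReal.rpow_pos (pos_iff_ne_zero.2 hV0) hVt).ne'
    have hUt : volume (cube a ρ) ^ t ≠ ∞ := ENNReal.rpow_ne_top_of_ne_zero hV0 hVt
    have hW0 := (hw.wMeas_pos a hρ).ne'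
    have hWt := (hw.wMeas_lt_top a ρ).ne
    have h1 : (∫⁻ y in cube a ρ, G y ^ t ∂μ) / μ (cube a ρ) ≤
        maximalFnOf μ (fun y => G y ^ t) x := by
      refine le_iSup₂_of_le a ρ (le_iSup₂_of_le hρ hx le_rfl)
    have h2 : ∫⁻ y in cube a ρ, G y ^ t ∂μ = ∫⁻ y in cube a ρ, G y ^ t * w y := by
      rw [hμ, restrict_withDensity (measurableSet_cube a ρ),
        lintegral_withDensity_eq_lintegral_mul₀ hw.aemeasurable.restrict hGt.restrict]
      simp only [Pi.mul_apply, mul_comm]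
    rw [h2, hμQ] at h1
    refine le_trans ?_ (mul_le_mul' le_rfl h1)
    rw [cubeAvg, ENNReal.div_rpow_of_nonneg _ _ ht0.le, ENNReal.div_le_iff hU0 hUt,
      mul_div_assoc', ← ENNReal.mul_div_right_comm, ENNReal.le_div_iff_mul_le (Or.inl hW0)
      (Or.inl hWt)]
    refine (hC a ρ hρ G hG).trans_eq ?_
    ring
  have hmeas : Measurable (maximalFn G) :=
    measurable_maximalFnOf (fun a ρ => volume_cube_lt_top a ρ) G
  have hstrong := maximalFnOf_strong_type (μ := μ) (D := D)
    (fun a ρ => by rw [hμQ]; exact hw.wMeas_lt_top a ρ)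
    (fun a ρ hρ => by rw [hμQ, hμQ]; exact hD a ρ hρ)
    (hGt.mono_ac (withDensity_absolutelyContinuous _ _)) hκ
  have eG : ∫⁻ x, (G x ^ t) ^ (v / t) ∂μ = ∫⁻ x, G x ^ v * w x := by
    rw [hμint _ (hGt.pow_const _)]
    refine lintegral_congr fun x => ?_
    rw [← ENNReal.rpow_mul, mul_div_cancel₀ _ ht0.ne']
  rw [eG] at hstrong
  rw [← hμint _ (hmeas.pow_const v).aemeasurable]
  calc ∫⁻ x, maximalFn G x ^ v ∂μ
      ≤ ∫⁻ x, (C : ℝ≥0∞) ^ (v / t) * maximalFnOf μ (fun y => G y ^ t) x ^ (v / t) ∂μ := by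
        refine lintegral_mono fun x => ?_
        refine (ENNReal.rpow_le_rpow (hpt x) hv0.le).trans_eq ?_
        rw [← ENNReal.rpow_mul, ← ENNReal.mul_rpow_of_nonneg _ _ hvt]
        congr 1
        field_simp
    _ = (C : ℝ≥0∞) ^ (v / t) * ∫⁻ x, maximalFnOf μ (fun y => G y ^ t) x ^ (v / t) ∂μ :=
        lintegral_const_mul' _ _ (ENNReal.rpow_ne_top_of_nonneg hvt ENNReal.coe_ne_top)
    _ ≤ (C : ℝ≥0∞) ^ (v / t) * _ := mul_le_mul' le_rfl hstrong
    _ = _ := by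
        have h2 : ((2 ^ (v / t - 1) : ℝ≥0) : ℝ≥0∞) = 2 ^ (v / t - 1) := by
          rw [ENNReal.coe_rpow_of_nonneg _ (by linarith)]
          rfl
        push_cast
        rw [h2, ENNReal.coe_rpow_of_nonneg _ hvt]
        simp only [ENNReal.ofReal]
        ring

end Maximal

/-! ### Decay of the dual weight and growth of local integrals -/

section DualWeight

variable {n : ℕ}

/-- The function whose maximal function enters into the dual weight. -/
noncomputable def dualDensity (s : ℝ) (h : Rn n → ℂ) (w : Rn n → ℝ≥0∞) (S : Set (Rn n)) :
    Rn n → ℝ≥0∞ :=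
  S.indicator fun y => ‖h y‖ₑ ^ s * w y ^ s

theorem aemeasurable_dualDensity {s t : ℝ} {h : Rn n → ℂ} {w : Rn n → ℝ≥0∞}
    (hw : AEMeasurable w volume) {a : Rn n} {ρ : ℝ} (hh : IsUnitOn t w (cube a ρ) h) :
    AEMeasurable (dualDensity s h w (cube a ρ)) volume := by
  rw [dualDensity, aemeasurable_indicator_iff (measurableSet_cube a ρ)]
  exact (hh.1.enorm.pow_const s).mul (hw.restrict.pow_const s)

/-- Since `u' + (1 - u') = 1`, the powers of `w` collapse to the single `w` in the norm of `h`. -/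
theorem lintegral_dualDensity {u s : ℝ} (hu : 1 < u) (hs : 1 < s) {w : Rn n → ℝ≥0∞}
    (hw0 : ∀ᵐ x, 0 < w x) (hwt : ∀ᵐ x, w x < ∞) {h : Rn n → ℂ} {a : Rn n} {ρ : ℝ}
    (hh : IsUnitOn (u / (u - 1)) w (cube a ρ) h) :
    ∫⁻ x, dualDensity s h w (cube a ρ) x ^ (u / (u - 1) / s) * w x ^ (-(u - 1)⁻¹) = 1 := by
  have hu1 : 0 < u - 1 := by linarith
  have hs0 : 0 < s := by linarith
  have hu' : 0 < u / (u - 1) := by positivity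
  have h1 : ∫⁻ x in cube a ρ, ‖h x‖ₑ ^ (u / (u - 1)) * w x = 1 := by
    have h2 := hh.2
    rw [lpwNorm, one_div] at h2
    rw [← ENNReal.rpow_inv_rpow hu'.ne' (∫⁻ x in cube a ρ, _), h2, ENNReal.one_rpow]
  rw [← h1, ← lintegral_indicator (measurableSet_cube a ρ)]
  refine lintegral_congr_ae ?_
  filter_upwards [hw0, hwt] with x h0 ht
  by_cases hx : x ∈ cube a ρ
  · simp only [dualDensity, indicator_of_mem hx]
    rw [ENNReal.mul_rpow_of_nonneg _ _ (by positivity), ← ENNReal.rpow_mul, ← ENNReal.rpow_mul,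
      mul_div_cancel₀ _ hs0.ne', mul_assoc, ← ENNReal.rpow_add _ _ h0.ne' ht.ne,
      show u / (u - 1) + -(u - 1)⁻¹ = 1 by field_simp; ring, ENNReal.rpow_one]
  · simp only [dualDensity, indicator_of_notMem hx]
    rw [ENNReal.zero_rpow_of_pos (by positivity), zero_mul]

/-- The decay of the maximal function away from the support. -/
theorem maximalFn_mul_le {G : Rn n → ℝ≥0∞} {a : Rn n} {ρ : ℝ} (hρ : 0 < ρ)
    (hG : ∀ x, x ∉ cube a ρ → G x = 0) {j : ℕ} {x : Rn n} (hx : x ∉ cube a (2 ^ (j + 1) * ρ)) :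
    maximalFn G x ≤ 2 ^ n * (2 ^ (-(j * n : ℝ)) * (wMeas G (cube a ρ) / volume (cube a ρ))) := by
  refine iSup_le fun b => iSup_le fun r => iSup_le fun hr => iSup_le fun hxb => ?_
  have hm : wMeas G (cube b r) = ∫⁻ y in cube b r ∩ cube a ρ, G y := by
    rw [wMeas, ← inter_comm, ← Measure.restrict_restrict (measurableSet_cube a ρ),
      ← lintegral_indicator (measurableSet_cube a ρ)]
    refine lintegral_congr fun y => ?_
    by_cases hy : y ∈ cube a ρ
    · rw [indicator_of_mem hy]
    · rw [indicator_of_notMem hy, hG y hy]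
  rcases (cube b r ∩ cube a ρ).eq_empty_or_nonempty with h0 | ⟨y, hy1, hy2⟩
  · rw [cubeAvg, hm, h0]
    simp
  have hle : wMeas G (cube b r) ≤ wMeas G (cube a ρ) := by
    rw [hm]
    exact lintegral_mono_set inter_subset_right
  -- A cube of half-side `r` meeting both the support and `x` satisfies `2^{j+1} ρ < 2r + ρ`; since
  -- `2^j ≥ 1`, this leaves `2r ≥ 2^j ρ`.
  have hr2 : 2 ^ j * (1 / 2) * ρ ≤ r := by
    simp only [cube, mem_ofPred_eq, not_forall, not_le] at hx
    obtain ⟨i, hi⟩ := hx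
    have h1 := hxb i
    have h2 := hy1 i
    have h3 := hy2 i
    have h4 : |x i - a i| ≤ 2 * r + ρ := by
      rw [abs_le] at h1 h2 h3 ⊢
      constructor <;> linarith
    have h5 : (1 : ℝ) ≤ 2 ^ j := one_le_pow₀ one_le_two
    rw [pow_succ] at hi
    nlinarith
  have hvol : 2 ^ (j * n : ℝ) * (2 ^ n)⁻¹ * volume (cube a ρ) ≤ volume (cube b r) := by
    calc _ = volume (cube b (2 ^ j * (1 / 2) * ρ)) := by
          rw [volume_cube_mul a b (by positivity), ENNReal.ofReal_mul (by positivity), mul_pow,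
            ENNReal.ofReal_pow (by norm_num), ← pow_mul, ← Nat.cast_mul, ENNReal.rpow_natCast,
            one_div, ENNReal.ofReal_inv_of_pos (by norm_num), ENNReal.inv_pow]
          simp
      _ ≤ _ := by
          rw [volume_cube, volume_cube]
          gcongr
  have hV0 : volume (cube a ρ) ≠ 0 := (volume_cube_pos a hρ).ne'
  have hVt : volume (cube a ρ) ≠ ∞ := (volume_cube_lt_top a ρ).ne
  have h20 : (2 : ℝ≥0∞) ^ (j * n : ℝ) ≠ 0 := (ENNReal.rpow_pos (by simp) (by simp)).ne'
  have h2t : (2 : ℝ≥0∞) ^ (j * n : ℝ) ≠ ∞ := ENNReal.rpow_ne_top_of_ne_zero (by simp) (by simp)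
  calc cubeAvg G b r ≤ wMeas G (cube a ρ) / (2 ^ (j * n : ℝ) * (2 ^ n)⁻¹ * volume (cube a ρ)) :=
        ENNReal.div_le_div hle hvol
    _ = _ := by
        rw [ENNReal.rpow_neg, div_eq_mul_inv, div_eq_mul_inv, ENNReal.mul_inv (Or.inr hVt)
          (Or.inr hV0), ENNReal.mul_inv (Or.inl h20) (Or.inl h2t), inv_inv]
        ring

theorem IsMuckenhoupt.volume_le {u : ℝ} (hu : 1 < u) {w : Rn n → ℝ≥0∞}
    (hw : IsMuckenhoupt u w) (a : Rn n) (ρ : ℝ) :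
    volume (cube a ρ) ≤ wMeas w (cube a ρ) ^ (1 / u) *
      wMeas (fun x => w x ^ (-(u - 1)⁻¹)) (cube a ρ) ^ ((u - 1) / u) := by
  have h := lintegral_mul_le_weighted (μ := volume.restrict (cube a ρ)) hw.aemeasurable.restrict
    (ae_restrict_of_ae hw.pos) (ae_restrict_of_ae hw.lt_top) hu (F := fun _ => 1) (G := fun _ => 1)
    aemeasurable_const aemeasurable_const
  simpa [wMeas] using h

theorem IsMuckenhoupt.bound_rpow {u : ℝ} (hu : 1 < u) {w : Rn n → ℝ≥0∞}
    (hw : IsMuckenhoupt u w) : ∃ C : ℝ≥0, ∀ (a : Rn n) (ρ : ℝ), 0 < ρ →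
      wMeas w (cube a ρ) ^ (1 / u) *
        wMeas (fun x => w x ^ (-(u - 1)⁻¹)) (cube a ρ) ^ ((u - 1) / u) ≤
          C * volume (cube a ρ) := by
  have hu0 : 0 < u := by linarith
  obtain ⟨C, hC⟩ := hw.bound
  refine ⟨C ^ u⁻¹, fun a ρ hρ => ?_⟩
  have h := ENNReal.rpow_le_rpow (hC a ρ hρ) (inv_nonneg.2 hu0.le)
  rw [ENNReal.mul_rpow_of_nonneg _ _ (inv_nonneg.2 hu0.le),
    ENNReal.mul_rpow_of_nonneg _ _ (inv_nonneg.2 hu0.le), ENNReal.rpow_rpow_inv hu0.ne',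
    ← ENNReal.rpow_mul, ← ENNReal.coe_rpow_of_nonneg _ (inv_nonneg.2 hu0.le)] at h
  rwa [one_div, div_eq_mul_inv]

/-- `Φ` is a function of cubes which, relative to `w(Q)^{1/p}`, decays along dilations. -/
def DilationDecay (p δ : ℝ) (w : Rn n → ℝ≥0∞) (Φ : Rn n → ℝ → ℝ≥0∞) : Prop :=
  ∃ C : ℝ≥0, ∀ (a : Rn n) (ρ : ℝ), 0 < ρ → ∀ j : ℕ,
    Φ a (2 ^ j * ρ) * wMeas w (cube a ρ) ^ (1 / p) * 2 ^ (j * δ) ≤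
      C * Φ a ρ * wMeas w (cube a (2 ^ j * ρ)) ^ (1 / p)

theorem DilationDecay.rpow {q u δ : ℝ} (hq : 0 < q) (hu : 1 < u) {w : Rn n → ℝ≥0∞}
    {Φ : Rn n → ℝ → ℝ≥0∞} (hΦ : DilationDecay (q * u) δ w Φ) :
    ∃ C : ℝ≥0, ∀ (a : Rn n) (ρ : ℝ), 0 < ρ → ∀ j : ℕ,
      Φ a (2 ^ j * ρ) ^ q * wMeas w (cube a ρ) ^ (1 / u) * 2 ^ (j * (δ * q)) ≤
        C * Φ a ρ ^ q * wMeas w (cube a (2 ^ j * ρ)) ^ (1 / u) := by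
  obtain ⟨C, hC⟩ := hΦ
  refine ⟨C ^ q, fun a ρ hρ j => ?_⟩
  have h := ENNReal.rpow_le_rpow (hC a ρ hρ j) hq.le
  have e : 1 / (q * u) * q = 1 / u := by field_simp
  simp only [ENNReal.mul_rpow_of_nonneg _ _ hq.le, ← ENNReal.rpow_mul, e] at h
  rwa [← ENNReal.coe_rpow_of_nonneg _ hq.le, mul_assoc (j : ℝ)] at h

theorem rpow_lintegral_le_of_lpwNorm_le {q u : ℝ} (hq : 0 < q) (hu : 1 < u) {w : Rn n → ℝ≥0∞}
    {f : Rn n → ℂ} {S : Set (Rn n)} {A : ℝ≥0∞} (h : lpwNorm (q * u) w S f ≤ A) :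
    (∫⁻ x in S, (‖f x‖ₑ ^ q) ^ u * w x) ^ (1 / u) ≤ A ^ q := by
  have hu0 : 0 < u := by linarith
  have h1 := ENNReal.rpow_le_rpow h hq.le
  rw [lpwNorm, ← ENNReal.rpow_mul, show 1 / (q * u) * q = 1 / u by field_simp] at h1
  simpa only [← ENNReal.rpow_mul] using h1

/-- Hölder's inequality on `R = 2^j Q` gives `(Φ(R)N)^q σ(R)^{1/u'}` with `σ = w^{1-u'}`. The
Muckenhoupt bound on `R` trades `σ(R)^{1/u'}` for `2^{jn}|Q| / w(R)^{1/u}`, dilation decay moves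
`Φ^q / w^{1/u}` from `R` to `Q`, and `|Q| ≤ w(Q)^{1/u} σ(Q)^{1/u'}` returns to `σ(Q)`. -/
theorem setLIntegral_cube_two_pow_le {q u δ : ℝ} (hq : 0 < q) (hu : 1 < u) {w : Rn n → ℝ≥0∞}
    (hw : IsMuckenhoupt u w) {Φ : Rn n → ℝ → ℝ≥0∞} (hΦ : DilationDecay (q * u) δ w Φ) :
    ∃ C : ℝ≥0, ∀ (a : Rn n) (ρ : ℝ), 0 < ρ → ∀ f : Rn n → ℂ, AEStronglyMeasurable f volume →
      ∀ N : ℝ≥0∞, (∀ r, 0 < r → lpwNorm (q * u) w (cube a r) f ≤ Φ a r * N) → ∀ j : ℕ,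
        (wMeas (fun x => w x ^ (-(u - 1)⁻¹)) (cube a ρ) ^ ((u - 1) / u))⁻¹ *
            ∫⁻ x in cube a (2 ^ j * ρ), ‖f x‖ₑ ^ q ≤
          C * 2 ^ (j * (n - δ * q)) * (Φ a ρ * N) ^ q := by
  obtain ⟨C₀, hC₀⟩ := hΦ.rpow hq hu
  obtain ⟨C₂, hC₂⟩ := hw.bound_rpow hu
  refine ⟨C₂ * C₀, fun a ρ hρ f hf N hN j => ?_⟩
  have hu1 : 0 < u - 1 := by linarith
  have hR : 0 < 2 ^ j * ρ := by positivity
  have i1 : ∫⁻ x in cube a (2 ^ j * ρ), ‖f x‖ₑ ^ q ≤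
      (∫⁻ x in cube a (2 ^ j * ρ), (‖f x‖ₑ ^ q) ^ u * w x) ^ (1 / u) *
        wMeas (fun x => w x ^ (-(u - 1)⁻¹)) (cube a (2 ^ j * ρ)) ^ ((u - 1) / u) := by
    have h := lintegral_mul_le_weighted (μ := volume.restrict (cube a (2 ^ j * ρ)))
      hw.aemeasurable.restrict (ae_restrict_of_ae hw.pos) (ae_restrict_of_ae hw.lt_top) hu
      (F := fun _ => 1) (G := fun x => ‖f x‖ₑ ^ q) aemeasurable_const
      (hf.restrict.enorm.pow_const q)
    simpa [wMeas] using h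
  have i2 := hC₂ a (2 ^ j * ρ) hR
  have i3 := hw.volume_le hu a ρ
  have i4 := rpow_lintegral_le_of_lpwNorm_le hq hu (hN _ hR)
  have i5 := hC₀ a ρ hρ j
  have hWP0 := ENNReal.rpow_pos (p := 1 / u) (hw.wMeas_pos a hR) (hw.wMeas_lt_top a _).ne
  have hWPt := ENNReal.rpow_ne_top_of_ne_zero (y := 1 / u) (hw.wMeas_pos a hR).ne'
    (hw.wMeas_lt_top a _).ne
  have hdual := hw.dual hu
  have hS0 := ENNReal.rpow_pos (p := (u - 1) / u) (hdual.wMeas_pos a hρ) (hdual.wMeas_lt_top a ρ).ne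
  have hSt := ENNReal.rpow_ne_top_of_ne_zero (y := (u - 1) / u) (hdual.wMeas_pos a hρ).ne'
    (hdual.wMeas_lt_top a ρ).ne
  have hVV := volume_cube_two_pow_mul a ρ j
  have hV0 : volume (cube a ρ) ≠ 0 := (volume_cube_pos a hρ).ne'
  have hVt : volume (cube a ρ) ≠ ∞ := (volume_cube_lt_top a ρ).ne
  rw [hVV] at i2
  set V := volume (cube a ρ)
  set E := ∫⁻ x in cube a (2 ^ j * ρ), ‖f x‖ₑ ^ q
  set Wa := wMeas w (cube a ρ) ^ (1 / u)
  set WPa := wMeas w (cube a (2 ^ j * ρ)) ^ (1 / u)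
  set Sb := wMeas (fun x => w x ^ (-(u - 1)⁻¹)) (cube a ρ) ^ ((u - 1) / u)
  set SPb := wMeas (fun x => w x ^ (-(u - 1)⁻¹)) (cube a (2 ^ j * ρ)) ^ ((u - 1) / u)
  set Ja := (∫⁻ x in cube a (2 ^ j * ρ), (‖f x‖ₑ ^ q) ^ u * w x) ^ (1 / u)
  have hT0 : (2 : ℝ≥0∞) ^ (j * (δ * q)) ≠ 0 := (ENNReal.rpow_pos (by simp) (by simp)).ne'
  have hTt : (2 : ℝ≥0∞) ^ (j * (δ * q)) ≠ ∞ := ENNReal.rpow_ne_top_of_ne_zero (by simp) (by simp)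
  rw [ENNReal.mul_rpow_of_nonneg _ _ hq.le] at i4 ⊢
  have k1 : E * Wa * 2 ^ (j * (δ * q)) ≤
      C₂ * C₀ * (2 ^ ((j : ℝ) * n) * V) * (Φ a ρ ^ q * N ^ q) := by
    rw [← ENNReal.mul_le_mul_iff_left hWP0.ne' hWPt]
    calc E * Wa * 2 ^ (j * (δ * q)) * WPa ≤ Ja * SPb * Wa * 2 ^ (j * (δ * q)) * WPa := by gcongr
      _ = Ja * (WPa * SPb) * Wa * 2 ^ (j * (δ * q)) := by ring
      _ ≤ (Φ a (2 ^ j * ρ) ^ q * N ^ q) * (C₂ * (2 ^ ((j : ℝ) * n) * V)) * Wa *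
          2 ^ (j * (δ * q)) := by gcongr
      _ = (Φ a (2 ^ j * ρ) ^ q * Wa * 2 ^ (j * (δ * q))) * N ^ q *
          (C₂ * (2 ^ ((j : ℝ) * n) * V)) := by ring
      _ ≤ (C₀ * Φ a ρ ^ q * WPa) * N ^ q * (C₂ * (2 ^ ((j : ℝ) * n) * V)) := by gcongr
      _ = _ := by ring
  have i3' : V * Sb⁻¹ ≤ Wa := by
    rw [← div_eq_mul_inv]
    exact ENNReal.div_le_of_le_mul i3
  rw [← ENNReal.mul_le_mul_iff_left (c := V * 2 ^ (j * (δ * q)))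
    (mul_ne_zero hV0 hT0) (ENNReal.mul_ne_top hVt hTt)]
  calc Sb⁻¹ * E * (V * 2 ^ (j * (δ * q))) = E * (V * Sb⁻¹) * 2 ^ (j * (δ * q)) := by ring
    _ ≤ E * Wa * 2 ^ (j * (δ * q)) := by gcongr
    _ ≤ _ := k1
    _ = C₂ * C₀ * (2 ^ (j * (n - δ * q)) * 2 ^ (j * (δ * q))) * V * (Φ a ρ ^ q * N ^ q) := by
        rw [← ENNReal.rpow_add _ _ (by simp) (by simp), ← mul_add, sub_add_cancel]
        ring
    _ = _ := by
        push_cast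
        ring

end DualWeight

/-! ### Embedding into the dual-weight space -/

section Core

variable {n : ℕ}

theorem measurable_dualWeight (s : ℝ) (h : Rn n → ℂ) (w : Rn n → ℝ≥0∞) (S : Set (Rn n)) :
    Measurable (dualWeight s h w S) :=
  (measurable_maximalFnOf (μ := volume) (fun a ρ => volume_cube_lt_top a ρ) _).pow_const _

/-- Both bounds rest on the openness of the class of `σ = w^{1-u'}`. The average of the density over
`Q` is controlled by the `A_v` condition for `σ` with `v = u'/s`, and the global norm by
Muckenhoupt's theorem on `L_v(σ)`. -/
theorem IsMuckenhoupt.exists_dualWeight_bounds {u : ℝ} (hu : 1 < u) {w : Rn n → ℝ≥0∞}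
    (hw : IsMuckenhoupt u w) : ∃ s₁ : ℝ, 1 < s₁ ∧ ∀ s, 1 < s → s ≤ s₁ → ∃ C₁ C₃ : ℝ≥0,
      ∀ (a : Rn n) (ρ : ℝ), 0 < ρ → ∀ h : Rn n → ℂ, IsUnitOn (u / (u - 1)) w (cube a ρ) h →
        (∀ (j : ℕ) (x), x ∉ cube a (2 ^ (j + 1) * ρ) → dualWeight s h w (cube a ρ) x ≤
          C₁ * 2 ^ (-(j * n : ℝ) * (1 / s)) *
            (wMeas (fun x => w x ^ (-(u - 1)⁻¹)) (cube a ρ) ^ ((u - 1) / u))⁻¹) ∧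
        (∫⁻ x, dualWeight s h w (cube a ρ) x ^ (u / (u - 1)) * w x ^ (-(u - 1)⁻¹)) ^
          ((u - 1) / u) ≤ C₃ := by
  have hu0 : 0 < u := by linarith
  have hu1 : 0 < u - 1 := by linarith
  have hdual := hw.dual hu
  have hu' : 1 < u / (u - 1) := (one_lt_div hu1).2 (by linarith)
  obtain ⟨t₀, ht0, htu, hM⟩ := hdual.exists_lt hu'
  set σ : Rn n → ℝ≥0∞ := fun x => w x ^ (-(u - 1)⁻¹) with hσ
  have hr : 1 < u / (u - 1) / t₀ := (one_lt_div (by linarith)).2 htu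
  -- The midpoint of `1` and `u'/t₀`, so that `s ≤ s₁` keeps `u'/s` strictly above `t₀`.
  refine ⟨(1 + u / (u - 1) / t₀) / 2, by linarith, fun s hs hs1 => ?_⟩
  have hs0 : 0 < s := by linarith
  set v := u / (u - 1) / s with hv
  have hv0 : t₀ < v := by
    rw [hv, lt_div_iff₀ hs0]
    have : s < u / (u - 1) / t₀ := by linarith
    rw [lt_div_iff₀ (by linarith)] at this
    linarith
  have hvu : v ≤ u / (u - 1) := div_le_self (by linarith) hs.le
  have hvpos : 0 < v := by linarith
  have hb : 0 ≤ (u - 1) / u := by positivity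
  obtain ⟨C, hC⟩ := (hM v hv0.le hvu).lintegral_rpow_mul_le (by linarith)
  obtain ⟨C', hC'⟩ := (hM t₀ le_rfl htu.le).lintegral_maximalFn_le ht0 hv0
  refine ⟨(2 ^ n) ^ (1 / s) * C ^ ((u - 1) / u), C' ^ ((u - 1) / u), fun a ρ hρ h hh => ?_⟩
  have hGm := aemeasurable_dualDensity (s := s) hw.aemeasurable hh
  have hG1 := lintegral_dualDensity hu hs hw.pos hw.lt_top hh
  have hd : ∀ x, dualWeight s h w (cube a ρ) x =
      maximalFn (dualDensity s h w (cube a ρ)) x ^ (1 / s) := fun x => rfl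
  have hG0 : ∀ x, x ∉ cube a ρ → dualDensity s h w (cube a ρ) x = 0 := fun x hx =>
    indicator_of_notMem hx _
  set G := dualDensity s h w (cube a ρ) with hG
  constructor
  · intro j x hx
    have h1 := ENNReal.rpow_le_rpow (maximalFn_mul_le hρ hG0 hx) (by positivity : 0 ≤ 1 / s)
    have h2 := hC a ρ hρ G hGm
    have h3 : ∫⁻ x in cube a ρ, G x ^ v * σ x ≤ 1 :=
      hG1 ▸ lintegral_mono' Measure.restrict_le_self le_rfl
    have hV0 : volume (cube a ρ) ≠ 0 := (volume_cube_pos a hρ).ne'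
    have hVt : volume (cube a ρ) ≠ ∞ := (volume_cube_lt_top a ρ).ne
    have hU0 : volume (cube a ρ) ^ v ≠ 0 := (ENNReal.rpow_pos (pos_iff_ne_zero.2 hV0) hVt).ne'
    have hUt : volume (cube a ρ) ^ v ≠ ∞ := ENNReal.rpow_ne_top_of_ne_zero hV0 hVt
    have hS0 := (hdual.wMeas_pos a hρ).ne'
    have hSt := (hdual.wMeas_lt_top a ρ).ne
    have h4 : (wMeas G (cube a ρ) / volume (cube a ρ)) ^ v ≤ C / wMeas σ (cube a ρ) := by
      rw [ENNReal.div_rpow_of_nonneg _ _ hvpos.le, ENNReal.div_le_iff hU0 hUt,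
        ← ENNReal.mul_div_right_comm, ENNReal.le_div_iff_mul_le (Or.inl hS0) (Or.inl hSt)]
      exact (h2.trans (mul_le_mul' le_rfl h3)).trans_eq (mul_one _)
    have h5 := ENNReal.rpow_le_rpow h4 hb
    rw [← ENNReal.rpow_mul, ENNReal.div_rpow_of_nonneg _ _ hb,
      show v * ((u - 1) / u) = 1 / s by rw [hv]; field_simp] at h5
    rw [hd]
    refine h1.trans ?_
    rw [ENNReal.mul_rpow_of_nonneg _ _ (by positivity),
      ENNReal.mul_rpow_of_nonneg _ _ (by positivity), ← ENNReal.rpow_mul]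
    calc _ ≤ (2 ^ n) ^ (1 / s) * (2 ^ (-(j * n : ℝ) * (1 / s)) *
          ((C : ℝ≥0∞) ^ ((u - 1) / u) / wMeas σ (cube a ρ) ^ ((u - 1) / u))) :=
          mul_le_mul' le_rfl (mul_le_mul' le_rfl h5)
      _ = _ := by
          rw [ENNReal.coe_mul, ENNReal.coe_rpow_of_nonneg _ hb,
            ENNReal.coe_rpow_of_nonneg _ (by positivity), ENNReal.div_eq_inv_mul]
          push_cast
          ring
  · rw [ENNReal.coe_rpow_of_nonneg _ hb]
    refine ENNReal.rpow_le_rpow ?_ hb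
    have h1 := hC' G hGm
    rw [hG1, mul_one] at h1
    refine le_trans (le_of_eq (lintegral_congr fun x => ?_)) h1
    rw [hd, ← ENNReal.rpow_mul, hv]
    congr 2
    field_simp

theorem isWeight_of_lintegral_rpow {u : ℝ} (hu : 1 < u) {w : Rn n → ℝ≥0∞}
    (hw : IsMuckenhoupt u w) {F : Rn n → ℝ≥0∞} (hF : Measurable F) {C : ℝ≥0}
    (h : (∫⁻ x, F x ^ (u / (u - 1)) * w x ^ (-(u - 1)⁻¹)) ^ ((u - 1) / u) ≤ C) : IsWeight F := by
  intro x
  refine ⟨cube x 1, cube_mem_nhds x one_pos, hF.aestronglyMeasurable, ?_⟩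
  have hb : 0 ≤ (u - 1) / u := div_nonneg (by linarith) (by linarith)
  have h1 := lintegral_mul_le_weighted (μ := volume.restrict (cube x 1))
    hw.aemeasurable.restrict (ae_restrict_of_ae hw.pos) (ae_restrict_of_ae hw.lt_top) hu
    (F := F) (G := fun _ => 1) hF.aemeasurable aemeasurable_const
  simp only [one_mul, ENNReal.one_rpow] at h1
  have h2 : ∫⁻ y in cube x 1, F y < ∞ := by
    refine h1.trans_lt (ENNReal.mul_lt_top ?_ ?_)
    · exact ENNReal.rpow_lt_top_of_nonneg (div_nonneg zero_le_one (by linarith))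
        (hw.wMeas_lt_top x 1).ne
    · refine lt_of_le_of_lt ?_ (h.trans_lt ENNReal.coe_lt_top)
      exact ENNReal.rpow_le_rpow (lintegral_mono' Measure.restrict_le_self le_rfl) hb
  simpa [HasFiniteIntegral] using h2

/-- The indices are shifted because the decay estimate with factor `2^{-jn}` holds outside the
dilate by `2^{j+1}`. -/
theorem univ_subset_annuli (a : Rn n) {ρ : ℝ} (hρ : 0 < ρ) : univ ⊆ cube a (2 ^ 1 * ρ) ∪
    ⋃ j : ℕ, cube a (2 ^ (j + 2) * ρ) \ cube a (2 ^ (j + 1) * ρ) := by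
  classical
  intro x _
  have hx := iUnion_cube_two_pow a hρ x
  obtain ⟨k, hk⟩ : ∃ k, Nat.find hx = k := ⟨_, rfl⟩
  have hmem := Nat.find_spec hx
  rw [hk] at hmem
  by_cases hk1 : k ≤ 1
  · exact Or.inl (cube_mono a (by gcongr; norm_num) hmem)
  · obtain ⟨j, rfl⟩ : ∃ j, k = j + 2 := ⟨k - 2, by omega⟩
    exact Or.inr (mem_iUnion.2 ⟨j, hmem, Nat.find_min hx (by omega)⟩)

/-- The embedding into the `L_q` space of a dual weight, for spaces of functions whose
`L_{p,w}(Q)`-norms are controlled by a function of cubes with dilation decay. -/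
theorem IsMuckenhoupt.exists_lpwNorm_dualWeight_le {q u : ℝ} (hq : 0 < q) (hu : 1 < u)
    {w : Rn n → ℝ≥0∞} (hw : IsMuckenhoupt u w) : ∃ s₁ : ℝ, 1 < s₁ ∧ ∀ s, 1 < s → s ≤ s₁ →
      (∀ (a : Rn n) (ρ : ℝ), 0 < ρ → ∀ h : Rn n → ℂ, IsUnitOn (u / (u - 1)) w (cube a ρ) h →
        IsWeight (dualWeight s h w (cube a ρ))) ∧
      ∀ δ, n * (1 - 1 / s) < δ * q → ∀ Φ, DilationDecay (q * u) δ w Φ → ∃ c : ℝ≥0,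
        ∀ (a : Rn n) (ρ : ℝ), 0 < ρ → ∀ h : Rn n → ℂ, IsUnitOn (u / (u - 1)) w (cube a ρ) h →
          ∀ f : Rn n → ℂ, AEStronglyMeasurable f volume → ∀ N : ℝ≥0∞,
            (∀ r, 0 < r → lpwNorm (q * u) w (cube a r) f ≤ Φ a r * N) →
              lpwNorm q (dualWeight s h w (cube a ρ)) univ f ≤ c * Φ a ρ * N := by
  have hu0 : 0 < u := by linarith
  have hu1 : 0 < u - 1 := by linarith
  have hb : 0 ≤ (u - 1) / u := by positivity
  obtain ⟨s₁, hs₁, H⟩ := hw.exists_dualWeight_bounds hu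
  refine ⟨s₁, hs₁, fun s hs hss => ?_⟩
  obtain ⟨C₁, C₃, hb13⟩ := H s hs hss
  refine ⟨fun a ρ hρ h hh => isWeight_of_lintegral_rpow hu hw (measurable_dualWeight _ _ _ _)
    (hb13 a ρ hρ h hh).2, fun δ hδ Φ hΦ => ?_⟩
  obtain ⟨C₂, hC₂⟩ := setLIntegral_cube_two_pow_le hq hu hw hΦ
  obtain ⟨C₀, hC₀⟩ := hΦ.rpow hq hu
  obtain ⟨D, hD⟩ := hw.doubling hu (c := 2) (by norm_num)
  -- The ratio of the geometric series over the annuli; the hypothesis on `δ` says that its exponent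
  -- is negative.
  set θ : ℝ≥0∞ := 2 ^ (n - n * (1 / s) - δ * q) with hθ
  have hθ1 : θ < 1 := by
    refine ENNReal.rpow_lt_one_of_one_lt_of_neg (by norm_num) ?_
    linarith
  set K : ℝ≥0∞ := C₀ * (D : ℝ≥0∞) ^ (1 / u) * 2 ^ (-(δ * q)) * C₃ +
    C₁ * C₂ * 2 ^ (2 * (n - δ * q)) * (1 - θ)⁻¹ with hK
  have hKt : K ≠ ∞ := by
    have h1 : (D : ℝ≥0∞) ^ (1 / u) ≠ ∞ :=
      ENNReal.rpow_ne_top_of_nonneg (by positivity) ENNReal.coe_ne_top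
    have h2 : ∀ x : ℝ, (2 : ℝ≥0∞) ^ x ≠ ∞ := fun x =>
      ENNReal.rpow_ne_top_of_ne_zero (by simp) (by simp)
    have h3 : (1 - θ)⁻¹ ≠ ∞ := ENNReal.inv_ne_top.2 (tsub_pos_of_lt hθ1).ne'
    refine ENNReal.add_ne_top.2 ⟨?_, ?_⟩
    · exact ENNReal.mul_ne_top (ENNReal.mul_ne_top (ENNReal.mul_ne_top ENNReal.coe_ne_top h1)
        (h2 _)) ENNReal.coe_ne_top
    · exact ENNReal.mul_ne_top (ENNReal.mul_ne_top (ENNReal.mul_ne_top ENNReal.coe_ne_top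
        ENNReal.coe_ne_top) (h2 _)) h3
  refine ⟨(K ^ (1 / q)).toNNReal, fun a ρ hρ h hh f hf N hN => ?_⟩
  rw [ENNReal.coe_toNNReal (ENNReal.rpow_ne_top_of_nonneg (by positivity) hKt)]
  obtain ⟨hoff, hcore⟩ := hb13 a ρ hρ h hh
  set F := dualWeight s h w (cube a ρ) with hF
  have hFm : Measurable F := measurable_dualWeight _ _ _ _
  set X := (Φ a ρ * N) ^ q with hX
  have hW0 := ENNReal.rpow_pos (p := 1 / u) (hw.wMeas_pos a hρ) (hw.wMeas_lt_top a _).ne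
  have hWt := ENNReal.rpow_ne_top_of_ne_zero (y := 1 / u) (hw.wMeas_pos a hρ).ne'
    (hw.wMeas_lt_top a _).ne
  -- On the double cube the duality pairing suffices; doubling of `w` replaces `Φ` on that cube by
  -- `Φ` on the original one.
  have hmain : ∫⁻ x in cube a (2 ^ 1 * ρ), ‖f x‖ₑ ^ q * F x ≤
      C₀ * (D : ℝ≥0∞) ^ (1 / u) * 2 ^ (-(δ * q)) * C₃ * X := by
    have k1 := lintegral_mul_le_weighted (μ := volume.restrict (cube a (2 ^ 1 * ρ)))
      hw.aemeasurable.restrict (ae_restrict_of_ae hw.pos) (ae_restrict_of_ae hw.lt_top) hu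
      (F := F) (G := fun x => ‖f x‖ₑ ^ q) hFm.aemeasurable (hf.restrict.enorm.pow_const q)
    have k2 := rpow_lintegral_le_of_lpwNorm_le hq hu (hN (2 ^ 1 * ρ) (by positivity))
    have k3 : (∫⁻ x in cube a (2 ^ 1 * ρ), F x ^ (u / (u - 1)) * w x ^ (-(u - 1)⁻¹)) ^
        ((u - 1) / u) ≤ C₃ :=
      (ENNReal.rpow_le_rpow (lintegral_mono' Measure.restrict_le_self le_rfl) hb).trans hcore
    have k4 : Φ a (2 ^ 1 * ρ) ^ q ≤
        C₀ * (D : ℝ≥0∞) ^ (1 / u) * 2 ^ (-(δ * q)) * Φ a ρ ^ q := by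
      have k5 := hC₀ a ρ hρ 1
      have k6 := ENNReal.rpow_le_rpow (hD a ρ hρ) (by positivity : 0 ≤ 1 / u)
      rw [ENNReal.mul_rpow_of_nonneg _ _ (by positivity)] at k6
      rw [← ENNReal.mul_le_mul_iff_left hW0.ne' hWt]
      have e1 : (2 : ℝ≥0∞) ^ (((1 : ℕ) : ℝ) * (δ * q)) * 2 ^ (-(δ * q)) = 1 := by
        rw [← ENNReal.rpow_add _ _ (by simp) (by simp)]
        simp
      calc _ = Φ a (2 ^ 1 * ρ) ^ q * wMeas w (cube a ρ) ^ (1 / u) *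
            (2 ^ (((1 : ℕ) : ℝ) * (δ * q)) * 2 ^ (-(δ * q))) := by rw [e1, mul_one]
        _ = Φ a (2 ^ 1 * ρ) ^ q * wMeas w (cube a ρ) ^ (1 / u) *
            2 ^ (((1 : ℕ) : ℝ) * (δ * q)) * 2 ^ (-(δ * q)) := by ring
        _ ≤ C₀ * Φ a ρ ^ q * wMeas w (cube a (2 ^ 1 * ρ)) ^ (1 / u) * 2 ^ (-(δ * q)) := by gcongr
        _ ≤ C₀ * Φ a ρ ^ q * ((D : ℝ≥0∞) ^ (1 / u) * wMeas w (cube a ρ) ^ (1 / u)) *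
            2 ^ (-(δ * q)) := by
            gcongr
            rwa [pow_one]
        _ = _ := by ring
    rw [ENNReal.mul_rpow_of_nonneg _ _ hq.le] at k2
    rw [hX, ENNReal.mul_rpow_of_nonneg _ _ hq.le]
    calc _ ≤ (Φ a (2 ^ 1 * ρ) ^ q * N ^ q) * C₃ := k1.trans (mul_le_mul' k2 k3)
      _ ≤ (C₀ * (D : ℝ≥0∞) ^ (1 / u) * 2 ^ (-(δ * q)) * Φ a ρ ^ q * N ^ q) * C₃ := by gcongr
      _ = _ := by ring
  have hann : ∀ j : ℕ, ∫⁻ x in cube a (2 ^ (j + 2) * ρ) \ cube a (2 ^ (j + 1) * ρ),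
      ‖f x‖ₑ ^ q * F x ≤ C₁ * C₂ * 2 ^ (2 * (n - δ * q)) * θ ^ j * X := by
    intro j
    have k1 := hC₂ a ρ hρ f hf N hN (j + 2)
    set Sb := (wMeas (fun x => w x ^ (-(u - 1)⁻¹)) (cube a ρ) ^ ((u - 1) / u))⁻¹
    have hA : MeasurableSet (cube a (2 ^ (j + 2) * ρ) \ cube a (2 ^ (j + 1) * ρ)) :=
      (measurableSet_cube _ _).diff (measurableSet_cube _ _)
    -- The outer cube has index `j + 2` while the weight decays with index `j`; the mismatch costs
    -- the constant `2^{2(n-δq)}`.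
    have e1 : (2 : ℝ≥0∞) ^ (-(j * n : ℝ) * (1 / s)) * 2 ^ (((j + 2 : ℕ) : ℝ) * (n - δ * q)) =
        2 ^ (2 * (n - δ * q)) * θ ^ j := by
      rw [hθ, ← ENNReal.rpow_natCast, ← ENNReal.rpow_mul,
        ← ENNReal.rpow_add _ _ (by simp) (by simp), ← ENNReal.rpow_add _ _ (by simp) (by simp)]
      congr 1
      push_cast
      ring
    calc _ ≤ ∫⁻ x in cube a (2 ^ (j + 2) * ρ) \ cube a (2 ^ (j + 1) * ρ),
          ‖f x‖ₑ ^ q * (C₁ * 2 ^ (-(j * n : ℝ) * (1 / s)) * Sb) := by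
          refine setLIntegral_mono' hA fun x hx => ?_
          gcongr
          exact hoff j x hx.2
      _ ≤ ∫⁻ x in cube a (2 ^ (j + 2) * ρ),
          ‖f x‖ₑ ^ q * (C₁ * 2 ^ (-(j * n : ℝ) * (1 / s)) * Sb) :=
          lintegral_mono_set sdiff_subset
      _ = (∫⁻ x in cube a (2 ^ (j + 2) * ρ), ‖f x‖ₑ ^ q) *
          (C₁ * 2 ^ (-(j * n : ℝ) * (1 / s)) * Sb) :=
          lintegral_mul_const'' _ (hf.restrict.enorm.pow_const q)
      _ = C₁ * 2 ^ (-(j * n : ℝ) * (1 / s)) *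
          (Sb * ∫⁻ x in cube a (2 ^ (j + 2) * ρ), ‖f x‖ₑ ^ q) := by ring
      _ ≤ C₁ * 2 ^ (-(j * n : ℝ) * (1 / s)) *
          (C₂ * 2 ^ (((j + 2 : ℕ) : ℝ) * (n - δ * q)) * X) := mul_le_mul' le_rfl k1
      _ = C₁ * C₂ * (2 ^ (-(j * n : ℝ) * (1 / s)) * 2 ^ (((j + 2 : ℕ) : ℝ) * (n - δ * q))) *
          X := by ring
      _ = _ := by rw [e1]; ring
  have htotal : ∫⁻ x in univ, ‖f x‖ₑ ^ q * F x ≤ K * X := by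
    calc _ ≤ ∫⁻ x in cube a (2 ^ 1 * ρ) ∪
          ⋃ j : ℕ, cube a (2 ^ (j + 2) * ρ) \ cube a (2 ^ (j + 1) * ρ), ‖f x‖ₑ ^ q * F x :=
          lintegral_mono_set (univ_subset_annuli a hρ)
      _ ≤ (∫⁻ x in cube a (2 ^ 1 * ρ), ‖f x‖ₑ ^ q * F x) +
          ∑' j : ℕ, ∫⁻ x in cube a (2 ^ (j + 2) * ρ) \ cube a (2 ^ (j + 1) * ρ),
            ‖f x‖ₑ ^ q * F x :=
          (lintegral_union_le _ _ _).trans (add_le_add le_rfl (lintegral_iUnion_le _ _))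
      _ ≤ C₀ * (D : ℝ≥0∞) ^ (1 / u) * 2 ^ (-(δ * q)) * C₃ * X +
          ∑' j : ℕ, C₁ * C₂ * 2 ^ (2 * (n - δ * q)) * θ ^ j * X :=
          add_le_add hmain (ENNReal.tsum_le_tsum hann)
      _ = K * X := by
          rw [ENNReal.tsum_mul_right, ENNReal.tsum_mul_left, ENNReal.tsum_geometric, hK, add_mul]
  rw [lpwNorm]
  refine (ENNReal.rpow_le_rpow htotal (by positivity : 0 ≤ 1 / q)).trans_eq ?_
  rw [ENNReal.mul_rpow_of_nonneg _ _ (by positivity), hX, ← ENNReal.rpow_mul,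
    mul_one_div_cancel hq.ne', ENNReal.rpow_one, mul_assoc]

end Core

/-! ### Decay for the two Morrey normalizations, and the polynomial weight -/

section Morrey

variable {n : ℕ}

theorem DilationDecay.mono {p δ δ' : ℝ} {w : Rn n → ℝ≥0∞} {Φ : Rn n → ℝ → ℝ≥0∞}
    (h : DilationDecay p δ w Φ) (hδ : δ' ≤ δ) : DilationDecay p δ' w Φ := by
  obtain ⟨C, hC⟩ := h
  refine ⟨C, fun a ρ hρ j => (mul_le_mul' le_rfl ?_).trans (hC a ρ hρ j)⟩
  exact ENNReal.rpow_le_rpow_of_exponent_le one_le_two (by gcongr)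

/-- Here `Φ / w(Q)^{1/p}` is `w(Q)^{-κ}`, so the growth of `w` along dilations is raised to the
power `κ`; it is applied with `κ = -r/n`. -/
theorem dilationDecay_wMeas {p κ : ℝ} (hκ : 0 < κ) {u : ℝ} {w : Rn n → ℝ≥0∞}
    (hw : IsMuckenhoupt u w) {τ : ℝ} (hτ : 1 < τ) (hR : RevHolder τ w) :
    DilationDecay p (n * (1 - 1 / τ) * κ) w fun a ρ => wMeas w (cube a ρ) ^ (1 / p - κ) := by
  obtain ⟨C, hC⟩ := hR.exists_decay hw.aemeasurable hτ
  refine ⟨C ^ κ, fun a ρ hρ j => ?_⟩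
  have hR : 0 < 2 ^ j * ρ := by positivity
  have h := ENNReal.rpow_le_rpow (hC a ρ hρ j) hκ.le
  have e : ∀ ρ, 0 < ρ → wMeas w (cube a ρ) ^ (1 / p) =
      wMeas w (cube a ρ) ^ (1 / p - κ) * wMeas w (cube a ρ) ^ κ := fun ρ hρ => by
    rw [← ENNReal.rpow_add _ _ (hw.wMeas_pos a hρ).ne' (hw.wMeas_lt_top a ρ).ne, sub_add_cancel]
  rw [ENNReal.mul_rpow_of_nonneg _ _ hκ.le, ENNReal.mul_rpow_of_nonneg _ _ hκ.le,
    ← ENNReal.rpow_mul, mul_assoc (j : ℝ)] at h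
  rw [e _ hρ, e _ hR, ENNReal.coe_rpow_of_nonneg _ hκ.le]
  set A := wMeas w (cube a ρ) ^ (1 / p - κ)
  set B := wMeas w (cube a (2 ^ j * ρ)) ^ (1 / p - κ)
  calc _ = B * A * (wMeas w (cube a ρ) ^ κ * 2 ^ (j * (n * (1 - 1 / τ) * κ))) := by ring
    _ ≤ B * A * ((C : ℝ≥0∞) ^ κ * wMeas w (cube a (2 ^ j * ρ)) ^ κ) := mul_le_mul' le_rfl h
    _ = _ := by ring

/-- The growth of `w(Q)^{1/p}` competes with that of `|Q|^e`. The resulting rate may have either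
sign; positivity is checked where the lemma is applied. -/
theorem dilationDecay_volume {p e : ℝ} (hp : 0 < p) (he : 0 ≤ e) {w : Rn n → ℝ≥0∞}
    (hw : AEMeasurable w volume) {τ : ℝ} (hτ : 1 < τ) (hR : RevHolder τ w) :
    DilationDecay p (n * (1 - 1 / τ) * (1 / p) - n * e) w fun a ρ => volume (cube a ρ) ^ e := by
  obtain ⟨C, hC⟩ := hR.exists_decay hw hτ
  have hp' : 0 ≤ 1 / p := by positivity
  refine ⟨C ^ (1 / p), fun a ρ hρ j => ?_⟩
  have h := ENNReal.rpow_le_rpow (hC a ρ hρ j) hp'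
  have hVV := volume_cube_two_pow_mul a ρ j
  rw [ENNReal.mul_rpow_of_nonneg _ _ hp', ENNReal.mul_rpow_of_nonneg _ _ hp',
    ← ENNReal.rpow_mul] at h
  beta_reduce
  rw [hVV, ENNReal.mul_rpow_of_nonneg _ _ he, ← ENNReal.rpow_mul, ENNReal.coe_rpow_of_nonneg _ hp']
  set A := volume (cube a ρ) ^ e
  have e1 : (2 : ℝ≥0∞) ^ ((j : ℝ) * n * e) * 2 ^ (j * (n * (1 - 1 / τ) * (1 / p) - n * e)) =
      2 ^ (j * (n * (1 - 1 / τ)) * (1 / p)) := by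
    rw [← ENNReal.rpow_add _ _ (by simp) (by simp)]
    congr 1
    ring
  calc _ = A * (wMeas w (cube a ρ) ^ (1 / p) * (2 ^ ((j : ℝ) * n * e) *
        2 ^ (j * (n * (1 - 1 / τ) * (1 / p) - n * e)))) := by ring
    _ ≤ A * ((C : ℝ≥0∞) ^ (1 / p) * wMeas w (cube a (2 ^ j * ρ)) ^ (1 / p)) := by
        rw [e1]
        exact mul_le_mul' le_rfl h
    _ = _ := by ring

theorem lpwNorm_le_morreyNorm {p r u : ℝ} {w : Rn n → ℝ≥0∞} (hw : IsMuckenhoupt u w)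
    (f : Rn n → ℂ) (a : Rn n) {ρ : ℝ} (hρ : 0 < ρ) :
    lpwNorm p w (cube a ρ) f ≤ wMeas w (cube a ρ) ^ (1 / p + r / n) * morreyNorm p r w f := by
  have h0 := (hw.wMeas_pos a hρ).ne'
  have ht := (hw.wMeas_lt_top a ρ).ne
  have h : wMeas w (cube a ρ) ^ (-(1 / p + r / n)) * lpwNorm p w (cube a ρ) f ≤
      morreyNorm p r w f := le_iSup₂_of_le a ρ (le_iSup_of_le hρ le_rfl)
  calc lpwNorm p w (cube a ρ) f = wMeas w (cube a ρ) ^ (1 / p + r / n) *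
        (wMeas w (cube a ρ) ^ (-(1 / p + r / n)) * lpwNorm p w (cube a ρ) f) := by
        rw [← mul_assoc, ← ENNReal.rpow_add _ _ h0 ht, add_neg_cancel, ENNReal.rpow_zero, one_mul]
    _ ≤ _ := mul_le_mul' le_rfl h

theorem lpwNorm_le_morreyLambdaNorm {p r : ℝ} (w : Rn n → ℝ≥0∞)
    (f : Rn n → ℂ) (a : Rn n) {ρ : ℝ} (hρ : 0 < ρ) :
    lpwNorm p w (cube a ρ) f ≤
      volume (cube a ρ) ^ (1 / p + r / n) * morreyLambdaNorm p r w f := by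
  have h0 := (volume_cube_pos a hρ).ne'
  have ht := (volume_cube_lt_top a ρ).ne
  have h : volume (cube a ρ) ^ (-(1 / p + r / n)) * lpwNorm p w (cube a ρ) f ≤
      morreyLambdaNorm p r w f := le_iSup₂_of_le a ρ (le_iSup_of_le hρ le_rfl)
  calc lpwNorm p w (cube a ρ) f = volume (cube a ρ) ^ (1 / p + r / n) *
        (volume (cube a ρ) ^ (-(1 / p + r / n)) * lpwNorm p w (cube a ρ) f) := by
        rw [← mul_assoc, ← ENNReal.rpow_add _ _ h0 ht, add_neg_cancel, ENNReal.rpow_zero, one_mul]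
    _ ≤ _ := mul_le_mul' le_rfl h

theorem embedsWith_of_le {N₁ N₂ : (Rn n → ℂ) → ℝ≥0∞} {C : ℝ≥0∞} (hC : C < ∞)
    (h : ∀ f, AEStronglyMeasurable f volume → N₂ f ≤ C * N₁ f) : EmbedsWith N₁ N₂ C :=
  fun f hf hN => ⟨(h f hf).trans_lt (ENNReal.mul_lt_top hC hN), h f hf⟩

/-- The polynomial weight is dominated by a dual weight. -/
theorem exists_polyWeight_le_dualWeight {u s : ℝ} (hu : 1 < u) (hs : 1 < s) {w : Rn n → ℝ≥0∞}
    (hw : IsMuckenhoupt u w) : ∃ (h : Rn n → ℂ) (K : ℝ≥0),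
      IsUnitOn (u / (u - 1)) w (cube 0 1) h ∧
      ∀ x, polyWeight n (n / s) x ≤ K * dualWeight s h w (cube 0 1) x := by
  have hu1 : 0 < u - 1 := by linarith
  have hs0 : 0 < s := by linarith
  have hu' : 0 < u / (u - 1) := by positivity
  have hS0 := ((hw.dual hu).wMeas_pos 0 one_pos).ne'
  have hSt := ((hw.dual hu).wMeas_lt_top 0 1).ne
  set S := wMeas (fun x => w x ^ (-(u - 1)⁻¹)) (cube 0 1) with hS
  set c : ℝ≥0∞ := S ^ (-(u / (u - 1))⁻¹) with hc
  have hc0 : c ≠ 0 := (ENNReal.rpow_pos (pos_iff_ne_zero.2 hS0) hSt).ne'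
  have hct : c ≠ ∞ := ENNReal.rpow_ne_top_of_ne_zero hS0 hSt
  have hcS : c ^ (u / (u - 1)) * S = 1 := by
    rw [hc, ← ENNReal.rpow_mul, neg_mul, inv_mul_cancel₀ hu'.ne', ENNReal.rpow_neg_one,
      ENNReal.inv_mul_cancel hS0 hSt]
  -- With this choice `|h| w` is almost everywhere the constant `c`, so the density is `c^s` on the
  -- unit cube. The constant is fixed by `∫ |h|^{u'} w = c^{u'} S`.
  set h : Rn n → ℂ := fun x => ((c * (w x)⁻¹).toReal : ℂ) with hh
  have hnorm : ∀ x, 0 < w x → ‖h x‖ₑ = c * (w x)⁻¹ := fun x hx => by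
    have hfin : c * (w x)⁻¹ ≠ ∞ := ENNReal.mul_ne_top hct (ENNReal.inv_ne_top.2 hx.ne')
    rw [hh, ← ofReal_norm, Complex.norm_real, Real.norm_of_nonneg ENNReal.toReal_nonneg,
      ENNReal.ofReal_toReal hfin]
  refine ⟨h, c⁻¹.toNNReal, ⟨?_, ?_⟩, fun x => ?_⟩
  · have : AEMeasurable (fun x => (c * (w x)⁻¹).toReal) volume :=
      (hw.aemeasurable.inv.const_mul c).ennreal_toReal
    exact (Complex.measurable_ofReal.comp_aemeasurable this).aestronglyMeasurable.restrict
  · have h1 : ∫⁻ x in cube 0 1, ‖h x‖ₑ ^ (u / (u - 1)) * w x = c ^ (u / (u - 1)) * S := by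
      rw [hS, wMeas, ← lintegral_const_mul'' _ (hw.aemeasurable.restrict.pow_const _)]
      refine lintegral_congr_ae (ae_restrict_of_ae ?_)
      filter_upwards [hw.pos, hw.lt_top] with x h0 ht
      rw [hnorm x h0, ENNReal.mul_rpow_of_nonneg _ _ hu'.le, mul_assoc, ← ENNReal.rpow_neg_one,
        ← ENNReal.rpow_mul (w x)]
      congr 1
      nth_rewrite 2 [← ENNReal.rpow_one (w x)]
      rw [← ENNReal.rpow_add _ _ h0.ne' ht.ne]
      congr 1
      field_simp
      ring
    rw [lpwNorm, h1, hcS, ENNReal.one_rpow]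
  · have hx1 : 0 < 1 + ‖x‖ := by positivity
    -- This cube contains both `x` and the support of the density and has volume comparable with `(1
    -- + |x|)^n`; it bounds the maximal function from below.
    have hmem : x ∈ cube (0 : Rn n) (1 + ‖x‖) := fun i => by
      have := PiLp.norm_apply_le x i
      rw [Real.norm_eq_abs] at this
      simp only [PiLp.zero_apply, sub_zero]
      linarith
    set g : Rn n → ℝ≥0∞ := (cube (0 : Rn n) 1).indicator fun y => ‖h y‖ₑ ^ s * w y ^ s with hg
    have hsub : cube (0 : Rn n) 1 ⊆ cube 0 (1 + ‖x‖) := cube_mono 0 (by simp)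
    have hgint : wMeas g (cube 0 (1 + ‖x‖)) = c ^ s * volume (cube (0 : Rn n) 1) := by
      rw [wMeas, hg, lintegral_indicator (measurableSet_cube 0 1),
        Measure.restrict_restrict (measurableSet_cube 0 1), inter_eq_left.2 hsub,
        ← setLIntegral_const]
      refine lintegral_congr_ae (ae_restrict_of_ae ?_)
      filter_upwards [hw.pos, hw.lt_top] with y h0 ht
      rw [hnorm y h0, ← ENNReal.mul_rpow_of_nonneg _ _ hs0.le, mul_assoc,
        ENNReal.inv_mul_cancel h0.ne' ht.ne, mul_one]
    have hV0 := (volume_cube_pos (0 : Rn n) one_pos).ne'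
    have hVt := (volume_cube_lt_top (0 : Rn n) 1).ne
    have hvol : volume (cube (0 : Rn n) (1 + ‖x‖)) =
        ENNReal.ofReal (1 + ‖x‖) ^ n * volume (cube (0 : Rn n) 1) := by
      rw [← volume_cube_mul 0 0 hx1.le, mul_one]
    have hE0 : ENNReal.ofReal (1 + ‖x‖) ≠ 0 := by simpa using hx1
    have hEt : ENNReal.ofReal (1 + ‖x‖) ≠ ∞ := ENNReal.ofReal_ne_top
    have hM : c ^ s * (ENNReal.ofReal (1 + ‖x‖) ^ n)⁻¹ ≤ maximalFn g x := by
      refine le_trans (le_of_eq ?_)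
        (le_iSup₂_of_le 0 (1 + ‖x‖) (le_iSup₂_of_le hx1 hmem le_rfl))
      rw [cubeAvg, hgint, hvol, ENNReal.mul_div_mul_right _ _ hV0 hVt, div_eq_mul_inv]
    have h2 := ENNReal.rpow_le_rpow hM (by positivity : 0 ≤ 1 / s)
    rw [ENNReal.mul_rpow_of_nonneg _ _ (by positivity), ← ENNReal.rpow_mul,
      mul_one_div_cancel hs0.ne', ENNReal.rpow_one, ← ENNReal.rpow_natCast, ← ENNReal.rpow_neg,
      ← ENNReal.rpow_mul] at h2
    have h3 : polyWeight n (n / s) x = ENNReal.ofReal (1 + ‖x‖) ^ (-(n : ℝ) * (1 / s)) := by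
      rw [polyWeight, ENNReal.ofReal_rpow_of_pos hx1]
      congr 2
      ring
    rw [ENNReal.coe_toNNReal (ENNReal.inv_ne_top.2 hc0), h3]
    calc _ = c⁻¹ * (c * ENNReal.ofReal (1 + ‖x‖) ^ (-(n : ℝ) * (1 / s))) := by
          rw [← mul_assoc, ENNReal.inv_mul_cancel hc0 hct, one_mul]
      _ ≤ _ := mul_le_mul' le_rfl h2

theorem lpwNorm_le_of_le {q : ℝ} (hq : 0 < q) {w w' : Rn n → ℝ≥0∞} {K : ℝ≥0}
    (h : ∀ x, w x ≤ K * w' x) (S : Set (Rn n)) (f : Rn n → ℂ) :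
    lpwNorm q w S f ≤ (K : ℝ≥0∞) ^ (1 / q) * lpwNorm q w' S f := by
  rw [lpwNorm, lpwNorm, ← ENNReal.mul_rpow_of_nonneg _ _ (by positivity)]
  refine ENNReal.rpow_le_rpow ?_ (by positivity)
  rw [← lintegral_const_mul' _ _ ENNReal.coe_ne_top]
  refine lintegral_mono fun x => ?_
  calc _ ≤ ‖f x‖ₑ ^ q * (K * w' x) := mul_le_mul' le_rfl (h x)
    _ = _ := by ring

/-- Both embeddings, for a quasinorm controlling the `L_{p,w}(Q)`-norms. -/
theorem exists_embedsWith {q u s δ : ℝ} (hq : 0 < q) (hu : 1 < u) (hs : 1 < s)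
    {w : Rn n → ℝ≥0∞} (hw : IsMuckenhoupt u w)
    (hcore : ∀ Φ, DilationDecay (q * u) δ w Φ → ∃ c : ℝ≥0,
        ∀ (a : Rn n) (ρ : ℝ), 0 < ρ → ∀ h : Rn n → ℂ, IsUnitOn (u / (u - 1)) w (cube a ρ) h →
          ∀ f : Rn n → ℂ, AEStronglyMeasurable f volume → ∀ N : ℝ≥0∞,
            (∀ r, 0 < r → lpwNorm (q * u) w (cube a r) f ≤ Φ a r * N) →
              lpwNorm q (dualWeight s h w (cube a ρ)) univ f ≤ c * Φ a ρ * N)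
    {N₁ : (Rn n → ℂ) → ℝ≥0∞} {Φ : Rn n → ℝ → ℝ≥0∞} (hΦ : DilationDecay (q * u) δ w Φ)
    (hΦt : ∀ a ρ, Φ a ρ < ∞)
    (hN : ∀ f a r, 0 < r → lpwNorm (q * u) w (cube a r) f ≤ Φ a r * N₁ f) :
    (∃ c : ℝ≥0, ∀ (a : Rn n) (ρ : ℝ), 0 < ρ → ∀ h : Rn n → ℂ,
      IsUnitOn (u / (u - 1)) w (cube a ρ) h →
        EmbedsWith N₁ (lpwNorm q (dualWeight s h w (cube a ρ)) univ) (c * Φ a ρ)) ∧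
    ∃ c : ℝ≥0, EmbedsWith N₁ (lpwNorm q (polyWeight n (n / s)) univ) c := by
  obtain ⟨c, hc⟩ := hcore Φ hΦ
  refine ⟨⟨c, fun a ρ hρ h hh => embedsWith_of_le (ENNReal.mul_lt_top ENNReal.coe_lt_top (hΦt a ρ))
    fun f hf => hc a ρ hρ h hh f hf _ (hN f a)⟩, ?_⟩
  obtain ⟨h, K, hh, hK⟩ := exists_polyWeight_le_dualWeight hu hs hw
  refine ⟨((K : ℝ≥0∞) ^ (1 / q) * (c * Φ 0 1)).toNNReal,
    embedsWith_of_le ENNReal.coe_lt_top fun f hf => ?_⟩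
  rw [ENNReal.coe_toNNReal (ENNReal.mul_ne_top
    (ENNReal.rpow_ne_top_of_nonneg (by positivity) ENNReal.coe_ne_top)
    (ENNReal.mul_ne_top ENNReal.coe_ne_top (hΦt 0 1).ne)), mul_assoc]
  exact (lpwNorm_le_of_le hq hK univ f).trans
    (mul_le_mul' le_rfl (hc 0 1 one_pos h hh f hf _ (hN f 0)))

/-- One `δ` has to serve all reverse Hölder exponents, because `s₀` and `α` are chosen before the
exponent. This is possible since the volume decay does not involve the exponent: a single admissible
one settles all of them. -/
theorem exists_dilationDecay (hn : 0 < n) {t p r : ℝ} (ht : 1 < t) (hp : 0 < p)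
    (he : 0 ≤ 1 / p + r / n) (hr0 : r < 0) {w : Rn n → ℝ≥0∞} (hw : IsMuckenhoupt t w) :
    ∃ δ : ℝ, 0 < δ ∧ DilationDecay p δ w (fun a ρ => wMeas w (cube a ρ) ^ (1 / p + r / n)) ∧
      ∀ τ : ℝ, 1 < τ → IsRH τ w → r ≤ -(n : ℝ) / (p * τ) →
        DilationDecay p δ w (fun a ρ => volume (cube a ρ) ^ (1 / p + r / n)) := by
  have hn' : (0 : ℝ) < n := by exact_mod_cast hn
  have hκ : 0 < -(r / n) := by
    rw [neg_pos]
    exact div_neg_of_neg_of_pos hr0 hn'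
  obtain ⟨δ₀, hδ₀, hRH⟩ := hw.revHolder ht
  have h1 := dilationDecay_wMeas (p := p) hκ hw (by linarith : 1 < 1 + δ₀) (hRH δ₀ hδ₀ le_rfl)
  rw [sub_neg_eq_add] at h1
  set δa := n * (1 - 1 / (1 + δ₀)) * -(r / n) with hδa
  have hδa0 : 0 < δa := by
    have : 1 / (1 + δ₀) < 1 := (div_lt_one (by linarith)).2 (by linarith)
    have : 0 < 1 - 1 / (1 + δ₀) := by linarith
    positivity
  by_cases hex : ∃ τ : ℝ, 1 < τ ∧ IsRH τ w ∧ r ≤ -(n : ℝ) / (p * τ)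
  · obtain ⟨τ, hτ, hR, hrτ⟩ := hex
    -- The rate is `-r - n/(pτ₁)`. Improving `τ` strictly keeps it positive in the borderline case
    -- `r = -n/(pτ)`.
    obtain ⟨τ₁, hττ, hR₁⟩ := hw.exists_revHolder_gt ht hτ (hR.revHolder hτ)
    have h2 := dilationDecay_volume hp he hw.aemeasurable (hτ.trans hττ) hR₁
    set δb := n * (1 - 1 / τ₁) * (1 / p) - n * (1 / p + r / n) with hδb
    have hδb0 : 0 < δb := by
      have e1 : δb = -r - n / (p * τ₁) := by
        rw [hδb]
        have : τ₁ ≠ 0 := by linarith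
        field_simp
        ring
      have h3 : n / (p * τ₁) < n / (p * τ) := by gcongr
      rw [neg_div] at hrτ
      rw [e1]
      linarith
    exact ⟨min δa δb, lt_min hδa0 hδb0, h1.mono (min_le_left _ _),
      fun _ _ _ _ => h2.mono (min_le_right _ _)⟩
  · exact ⟨δa, hδa0, h1, fun τ hτ hR hrτ => absurd ⟨τ, hτ, hR, hrτ⟩ hex⟩

end Morrey

end WeightedMorrey

/-! ### Choice of parameters and conclusion -/

open WeightedMorrey in
theorem mainTheorem4 (n : ℕ) (γ p r : ℝ) (w : WeightedMorrey.Rn n → ℝ≥0∞)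
    (hγ : 1 ≤ γ) (hγp : γ < p) (hr : -(n : ℝ) / p ≤ r) (hr0 : r < 0)
    (hw : WeightedMorrey.IsAp (p / γ) w) :
    ∃ q₀ : ℝ, γ < q₀ ∧ q₀ < p ∧ ∀ q : ℝ, γ ≤ q → q ≤ q₀ →
      (∃ s₀ : ℝ, 1 < s₀ ∧ ∀ s : ℝ, 1 < s → s ≤ s₀ →
        (∃ c : ℝ≥0, ∀ (a : WeightedMorrey.Rn n) (ρ : ℝ), 0 < ρ →
          ∀ h : WeightedMorrey.Rn n → ℂ,
            WeightedMorrey.IsUnitOn (Real.conjExponent (p / q)) w (WeightedMorrey.cube a ρ) h →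
            WeightedMorrey.IsWeight
              (WeightedMorrey.dualWeight s h w (WeightedMorrey.cube a ρ)) ∧
            WeightedMorrey.EmbedsWith
              (WeightedMorrey.morreyNorm p r w)
              (WeightedMorrey.lpwNorm q
                (WeightedMorrey.dualWeight s h w (WeightedMorrey.cube a ρ)) univ)
              (c * WeightedMorrey.wMeas w (WeightedMorrey.cube a ρ) ^ (1 / p + r / n))) ∧
        (∀ σ : ℝ, 1 < σ → WeightedMorrey.IsRH σ w → r ≤ -(n : ℝ) / (p * σ) →
          ∃ c : ℝ≥0, ∀ (a : WeightedMorrey.Rn n) (ρ : ℝ), 0 < ρ →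
          ∀ h : WeightedMorrey.Rn n → ℂ,
            WeightedMorrey.IsUnitOn (Real.conjExponent (p / q)) w (WeightedMorrey.cube a ρ) h →
            WeightedMorrey.EmbedsWith
              (WeightedMorrey.morreyLambdaNorm p r w)
              (WeightedMorrey.lpwNorm q
                (WeightedMorrey.dualWeight s h w (WeightedMorrey.cube a ρ)) univ)
              (c * volume (WeightedMorrey.cube a ρ) ^ (1 / p + r / n)))) ∧
      (∃ α : ℝ, 0 < α ∧ α < n ∧
        (∃ c : ℝ≥0, WeightedMorrey.EmbedsWith
          (WeightedMorrey.morreyNorm p r w)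
          (WeightedMorrey.lpwNorm q (WeightedMorrey.polyWeight n α) univ) c) ∧
        (∀ σ : ℝ, 1 < σ → WeightedMorrey.IsRH σ w → r ≤ -(n : ℝ) / (p * σ) →
          ∃ c : ℝ≥0, WeightedMorrey.EmbedsWith
            (WeightedMorrey.morreyLambdaNorm p r w)
            (WeightedMorrey.lpwNorm q (WeightedMorrey.polyWeight n α) univ) c)) := by
  have hn : 0 < n := by
    rcases Nat.eq_zero_or_pos n with rfl | hn
    · simp at hr
      linarith
    · exact hn
  have hn' : (0 : ℝ) < n := by exact_mod_cast hn
  have hγ0 : 0 < γ := by linarith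
  have hp : 0 < p := by linarith
  have ht : 1 < p / γ := (one_lt_div hγ0).2 hγp
  have hM := hw.isMuckenhoupt ht
  have he : 0 ≤ 1 / p + r / n := by
    have h1 : -(n : ℝ) / p / n ≤ r / n := by gcongr
    have h2 : -(n : ℝ) / p / n = -(1 / p) := by field_simp
    linarith
  obtain ⟨t₀, ht0, ht0t, hMt⟩ := hM.exists_lt ht
  obtain ⟨δ, hδ, hdecay, hdecayRH⟩ := exists_dilationDecay hn ht hp he hr0 hM
  have ht00 : 0 < t₀ := by linarith
  -- With `q₀ = p/t₀`, the range `γ ≤ q ≤ q₀` is the range `t₀ ≤ p/q ≤ p/γ` on which `w` stays in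
  -- the Muckenhoupt class.
  refine ⟨p / t₀, ?_, div_lt_self hp ht0, fun q hq hqq => ?_⟩
  · rw [lt_div_iff₀ hγ0] at ht0t
    rw [lt_div_iff₀ ht00]
    linarith
  have hq0 : 0 < q := by linarith
  have hut : t₀ ≤ p / q := by
    rw [le_div_iff₀ ht00] at hqq
    rw [le_div_iff₀ hq0]
    linarith
  have hMu : IsMuckenhoupt (p / q) w := hMt _ hut (by gcongr)
  have hu : 1 < p / q := by linarith
  have hpu : q * (p / q) = p := by field_simp
  obtain ⟨s₁, hs₁, hcore⟩ := hMu.exists_lpwNorm_dualWeight_le hq0 hu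
  have hs₂ : 0 < δ * q / (2 * n) := by positivity
  -- Since `1 - 1/s ≤ s - 1`, the bound on `s` leaves `n(1 - 1/s)` at most half of `δq`, and the
  -- annuli are summable.
  have hsδ : ∀ s, 1 < s → s ≤ 1 + δ * q / (2 * n) → n * (1 - 1 / s) < δ * q := by
    intro s hs hss
    have h1 : 1 - 1 / s ≤ s - 1 := by
      have hs0 : 0 < s := by linarith
      rw [← sub_nonneg]
      have : s - 1 - (1 - 1 / s) = (s - 1) ^ 2 / s := by field_simp
      rw [this]
      positivity
    calc n * (1 - 1 / s) ≤ n * (δ * q / (2 * n)) := by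
          gcongr
          linarith
      _ = δ * q / 2 := by field_simp
      _ < δ * q := half_lt_self (by positivity)
  have hΦt : ∀ (a : Rn n) (ρ : ℝ), wMeas w (cube a ρ) ^ (1 / p + r / n) < ∞ := fun a ρ =>
    ENNReal.rpow_lt_top_of_nonneg he (hM.wMeas_lt_top a ρ).ne
  have hΦt' : ∀ (a : Rn n) (ρ : ℝ), volume (cube a ρ) ^ (1 / p + r / n) < ∞ := fun a ρ =>
    ENNReal.rpow_lt_top_of_nonneg he (volume_cube_lt_top a ρ).ne
  have hemb : ∀ s, 1 < s → s ≤ min s₁ (1 + δ * q / (2 * n)) → _ := fun s hs hss =>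
    exists_embedsWith (N₁ := morreyNorm p r w) hq0 hu hs hMu
      ((hcore s hs (hss.trans (min_le_left _ _))).2 δ (hsδ s hs (hss.trans (min_le_right _ _))))
      (by rw [hpu]; exact hdecay) hΦt
      (fun f a ρ hρ => by rw [hpu]; exact lpwNorm_le_morreyNorm hM f a hρ)
  have hembRH : ∀ s, 1 < s → s ≤ min s₁ (1 + δ * q / (2 * n)) → ∀ τ : ℝ, 1 < τ → IsRH τ w →
      r ≤ -(n : ℝ) / (p * τ) → _ := fun s hs hss τ hτ hR hrτ =>
    exists_embedsWith (N₁ := morreyLambdaNorm p r w) hq0 hu hs hMu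
      ((hcore s hs (hss.trans (min_le_left _ _))).2 δ (hsδ s hs (hss.trans (min_le_right _ _))))
      (by rw [hpu]; exact hdecayRH τ hτ hR hrτ) hΦt'
      (fun f a ρ hρ => by rw [hpu]; exact lpwNorm_le_morreyLambdaNorm w f a hρ)
  have hs₀ : 1 < min s₁ (1 + δ * q / (2 * n)) := lt_min hs₁ (by linarith)
  set s₀ := min s₁ (1 + δ * q / (2 * n)) with hs₀_def
  -- The exponent `α = n/s₀` is the decay rate of the dual weight with the largest admissible `s`.
  refine ⟨⟨s₀, hs₀, fun s hs hss => ⟨?_, fun τ hτ hR hrτ => ?_⟩⟩,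
    ⟨n / s₀, by positivity, div_lt_self hn' hs₀, (hemb s₀ hs₀ le_rfl).2,
      fun τ hτ hR hrτ => (hembRH s₀ hs₀ le_rfl τ hτ hR hrτ).2⟩⟩
  · obtain ⟨c, hc⟩ := (hemb s hs hss).1
    exact ⟨c, fun a ρ hρ h hh =>
      ⟨(hcore s hs (hss.trans (min_le_left _ _))).1 a ρ hρ h hh, hc a ρ hρ h hh⟩⟩
  · exact (hembRH s hs hss τ hτ hR hrτ).1
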